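/- Notation. Let $\alpha$ be irrational with $0<\alpha<\tfrac12$, and let $\gamma$ be a real number with $\gamma\notin\mathbb Z+\alpha\mathbb Z$. Write $\|x\|$ for the distance from $x$ to the nearest integer, $\{x\}$ for the fractional part of $x$, and $$M(\alpha,\gamma)=\liminf_{|n|\to\infty}|n|\,\|n\alpha-\gamma\| .$$ Consider one of the following two continued fraction expansions $$\alpha=a_0+\cfrac{\varepsilon_1}{a_1+\cfrac{\varepsilon_2}{a_2+\cdots}},\qquad \varepsilon_i=\pm1,$$ in both of which $a_0=0$, $\varepsilon_1=1$, $\alpha_0=\alpha$. * The nearest integer expansion: for $i\ge 0$, $\alpha_{i+1}=\|1/\alpha_i\|$, and $(a_{i+1},\varepsilon_{i+2})=(\lfloor 1/\alpha_i\rfloor,1)$ if $\|1/\alpha_i\|=\{1/\alpha_i\}$, $(a_{i+1},\varepsilon_{i+2})=(\lceil 1/\alpha_i\rceil,-1)$ otherwise. * The regular expansion: for $i\ge 0$, $a_{i+1}=\lfloor 1/\alpha_i\rfloor$, $\varepsilon_{i+2}=1$, $\alpha_{i+1}=\{1/\alpha_i\}$. For the chosen expansion let $p_i/q_i$ be the convergents,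 $D_i=|q_i\alpha-p_i|$, and $R=\liminf_{i\to\infty}a_i$. When $R$ is finite, let $R_*=R$ if $R$ is odd and $R_*=R+1$ if $R$ is even. Let $$\gamma_*=\sum_{i\ge1}\tfrac12(a_i-1+\varepsilon_i+\lambda_i)D_{i-1},$$ where $\lambda_i=0$ if $a_i$ is even and $\lambda_i=(-1)^j$ if $a_i$ is the $j$-th odd number among $a_1,a_2,\dots$. Set $\gamma_0=\{\gamma\}$ and, for $i\ge 0$, $c_{i+1}=\lfloor\gamma_i/\alpha_i\rfloor$, $\gamma_{i+1}=\{\gamma_i/\alpha_i\}$ (so that $\{\gamma\}=\sum_{i\ge1}c_iD_{i-1}$), and define the integers $t_i$ by $c_i=\tfrac12(a_i-1+\varepsilon_i+t_i)$. Theorem 7. Suppose that $R\ge4$ is finite and that $$M(\alpha,\gamma)>M(\alpha,\gamma_*)-R_*^{-3}.$$ (1) If the expansion is the nearest integer expansion of $\alpha$, then $|t_i|<\dfrac{3a_i}{R}$ for all but finitely many $i$. In particular, for all but finitely many $k$ with $a_k=R$, one has $t_k=\pm1$ if $a_k$ is odd, and $t_k\in\{0,2,-2\}$ if $a_k$ is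 even. (2) If the expansion is the regular continued fraction expansion of $\alpha$, then $|t_i|<\dfrac{2a_i}{R_*-1}$ for all but finitely many $i$. Moreover, for all but finitely many $k$ with $a_k=R$, one has $t_k=\pm1$ if $a_k$ is odd, and $t_k=0$ if $a_k$ is even. -/

import Mathlib

open Filter

noncomputable section

namespace InhomApprox

/-- Distance from `x` to the nearest integer. -/
def distInt (x : ℝ) : ℝ := |x - round x|

/-- The two-sided inhomogeneous approximation constant
`M(α, γ) = liminf_{|n| → ∞} |n| ‖n α - γ‖`, as an extended real. -/
def M (α γ : ℝ) : EReal :=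
  liminf (fun n : ℤ => ((|(n : ℝ)| * distInt (n * α - γ) : ℝ) : EReal)) cofinite

/-- The data of a continued fraction expansion
`a 0 + ε 1 / (a 1 + ε 2 / (a 2 + ε 3 / (a 3 + ⋯)))`, together with its tails `tail i = α_i`.
The value `ε 0` plays no role. -/
structure Expansion where
  a : ℕ → ℤ
  ε : ℕ → ℤ
  tail : ℕ → ℝ

/-- Tails of the nearest integer expansion: `α_0 = α`, `α_{i+1} = ‖1 / α_i‖`. -/
def nearestTail (α : ℝ) : ℕ → ℝ
  | 0 => α
  | i + 1 => distInt (nearestTail α i)⁻¹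

open Classical in
/-- The nearest integer continued fraction expansion of `α ∈ (0, 1/2)`. With `x = 1 / α_i`,
`(a_{i+1}, ε_{i+2})` is `(⌊x⌋, 1)` if `‖x‖ = {x}` and `(⌈x⌉, -1)` otherwise. -/
def nearest (α : ℝ) : Expansion where
  a := fun
    | 0 => 0
    | i + 1 =>
      if distInt (nearestTail α i)⁻¹ = Int.fract (nearestTail α i)⁻¹
      then ⌊(nearestTail α i)⁻¹⌋ else ⌈(nearestTail α i)⁻¹⌉
  ε := fun
    | 0 => 1
    | 1 => 1
    | i + 2 =>
      if distInt (nearestTail α i)⁻¹ = Int.fract (nearestTail α i)⁻¹ then 1 else -1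
  tail := nearestTail α

/-- Tails of the regular expansion: `α_0 = α`, `α_{i+1} = {1 / α_i}`. -/
def regularTail (α : ℝ) : ℕ → ℝ
  | 0 => α
  | i + 1 => Int.fract (regularTail α i)⁻¹

/-- The regular continued fraction expansion of `α ∈ (0, 1)`. -/
def regular (α : ℝ) : Expansion where
  a := fun
    | 0 => 0
    | i + 1 => ⌊(regularTail α i)⁻¹⌋
  ε := fun _ => 1
  tail := regularTail α

namespace Expansion

variable (E : Expansion)

/-- Numerators of the convergents (with `p_{-1} = 1`). -/
def p : ℕ → ℤ
  | 0 => E.a 0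
  | 1 => E.a 1 * E.a 0 + E.ε 1
  | i + 2 => E.a (i + 2) * p (i + 1) + E.ε (i + 2) * p i

/-- Denominators of the convergents (with `q_{-1} = 0`). -/
def q : ℕ → ℤ
  | 0 => 1
  | 1 => E.a 1
  | i + 2 => E.a (i + 2) * q (i + 1) + E.ε (i + 2) * q i

/-- `D_i = |q_i α - p_i|`. -/
def D (α : ℝ) (i : ℕ) : ℝ := |(E.q i : ℝ) * α - E.p i|

/-- `R = liminf a_i`, in the extended reals. -/
def R : EReal := liminf (fun i : ℕ => (((E.a i : ℤ) : ℝ) : EReal)) atTop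

/-- `lam i` is `0` if `a_i` is even and `(-1)^j` if `a_i` is the `j`-th odd number among
`a_1, a_2, …`. -/
def lam (i : ℕ) : ℤ :=
  if Odd (E.a i) then (-1) ^ ((Finset.Icc 1 i).filter fun k => Odd (E.a k)).card else 0

/-- `γ_* = ∑_{i ≥ 1} (1/2) (a_i - 1 + ε_i + λ_i) D_{i-1}`. -/
def gammaStar (α : ℝ) : ℝ :=
  ∑' i : ℕ, (1 / 2 : ℝ) * ((E.a (i + 1) - 1 + E.ε (i + 1) + E.lam (i + 1) : ℤ) : ℝ) * E.D α i

/-- Remainders of the `α`-expansion of `{γ}`: `γ_0 = {γ}`, `γ_{i+1} = {γ_i / α_i}`. -/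
def gammaRem (γ : ℝ) : ℕ → ℝ
  | 0 => Int.fract γ
  | i + 1 => Int.fract (gammaRem γ i / E.tail i)

/-- Coefficients of the `α`-expansion `{γ} = ∑_{i ≥ 1} c_i D_{i-1}`: `c_{i+1} = ⌊γ_i / α_i⌋`.
The value at `0` plays no role. -/
def c (γ : ℝ) : ℕ → ℤ
  | 0 => 0
  | i + 1 => ⌊E.gammaRem γ i / E.tail i⌋

/-- The integers `t_i` with `c_i = (1/2) (a_i - 1 + ε_i + t_i)`. -/
def t (γ : ℝ) (i : ℕ) : ℤ := 2 * E.c γ i - E.a i + 1 - E.ε i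

end Expansion

/-- The least odd integer that is at least `R`. -/
def oddCeil (R : ℤ) : ℤ := if Odd R then R else R + 1

end InhomApprox

end

noncomputable section

/-! ### Tails, convergents and the odd grid coordinates of each level -/

namespace InhomApprox

namespace Expansion

/-! At each level k the integer points (n, P) are indexed by pairs (m, l) of odd integers, and 4 |n|
|nα − P − γ| `detFactor k` = |X| |Y| with X = b + m + l y and Y = −f + l − m ε x. Here ε = ε_{k+1},
x = α_k and y = q_{k−1}/q_k are the forward and backward tails, and f and b are the normalised
forward and backward sums of the digits t_i. The four points with m, l = ±1, the vertices of the
level, control M from both sides.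

Upper bound. If c < M(α, γ), all vertices of large level have |X| |Y| > 4c `detFactor k`
(`IsDigitRep.eventually_lt_vertex`). Two vertices of level k and two of level k + 1 lie on a common
row l = ±1, along which the suitably scaled product is |w + M| |d + z − M|, with d = a_{k+1} −
|t_{k+1}| and M running over odd integers; they sit at M = ±1 and M = d ± 1. Once |w|, |z| ≤ 1,
adding the four inequalities cancels w and z and leaves 4c W < a_{k+1} − |t_{k+1}|, where W =
a_{k+1} + ε_{k+2} α_{k+1} + ε_{k+1} q_{k−1}/q_k (`lt_sub_abs_digit`). That w and z are essentially
in this range is itself forced by the vertices: first f (`abs_fwd_lt`), then the digits, then b by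
contraction.

Lower bound. A point with |n| large is followed through the levels until |l| stops decreasing. There
it either lies on a row l = ±1, where concavity compares it with the vertices, or it has |l| ≥ 3 and
a large product (`le_product_of_turn`). Hence a bound Λ `detFactor k` valid at all vertices of large
level gives M ≥ Λ/4 (`IsDigitRep.le_M`). For γ_* the digits vanish at even quotients and alternate
in sign at odd ones, so f and b stay small, and after an odd quotient they have opposite signs.
Checking the vertices becomes a list of inequalities indexed by the parities of two neighbouring
quotients (`eventually_vertexGe_star`).

Combination. With Λ = κ + 4 R_*⁻³ the hypothesis yields M(α, γ) > κ/4, hence κ W < a − |t|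
eventually. The choice κ = (R_* − 3)/(R_* − 1) (regular), or κ = (R − 3)/(R − 2θ) with θ bounding
the tails (nearest integer, R ≥ 5; κ = 9/25 if R = 4), turns this into the digit bounds. The values
at a_k = R follow from t_k ≡ a_k mod 2. -/

/-- The properties of the nearest integer and of the regular expansion of `α` that are used
throughout. -/
structure IsExpansionOf (E : Expansion) (α : ℝ) : Prop where
  a_zero : E.a 0 = 0
  eps_one : E.ε 1 = 1
  tail_zero : E.tail 0 = α
  eps_cases : ∀ i, E.ε i = 1 ∨ E.ε i = -1
  tail_pos : ∀ i, 0 < E.tail i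
  tail_lt_one : ∀ i, E.tail i < 1
  tail_inv : ∀ i, (E.tail i)⁻¹ = E.a (i + 1) + E.ε (i + 2) * E.tail (i + 1)
  one_le_a : ∀ i, 1 ≤ E.a (i + 1)
  two_le_a : ∀ i, E.ε (i + 1) = -1 → 2 ≤ E.a (i + 1)

variable (E : Expansion)

/-- The backward tails `q_{k-1} / q_k`. -/
def back : ℕ → ℝ
  | 0 => 0
  | k + 1 => (E.a (k + 1) + E.ε (k + 1) * back k)⁻¹

/-- The denominators of the convergents as real numbers, as products of inverse backward tails. -/
def den : ℕ → ℝ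
  | 0 => 1
  | k + 1 => den k * (E.a (k + 1) + E.ε (k + 1) * E.back k)

/-- The products `α_0 ⋯ α_{k-1} = D_{k-1}`. -/
def tailProd : ℕ → ℝ
  | 0 => 1
  | k + 1 => tailProd k * E.tail k

/-- The sign of `q_{k-1} α - p_{k-1}`. -/
def sgn : ℕ → ℤ
  | 0 => -1
  | k + 1 => -E.ε (k + 1) * sgn k

/-- The determinant factor `1 + ε_{k+1} α_k (q_{k-1} / q_k)`. -/
def detFactor (k : ℕ) : ℝ := 1 + E.ε (k + 1) * E.tail k * E.back k

/-- The normalised backward sums `∑_{i ≤ k} ± t_i q_{i-1} / q_k`. -/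
def backSum (t : ℕ → ℤ) : ℕ → ℝ
  | 0 => -1
  | k + 1 => E.back (k + 1) * (t (k + 1) - E.ε (k + 1) * backSum t k)

/-- `t` and `f` describe an expansion `γ = ∑ (1/2) (a_i - 1 + ε_i + t_i) D_{i-1}` modulo `1`, with
`f k` the normalised forward sum `∑_{i > k} t_i D_{i-1} / D_{k-1}`. -/
structure IsDigitRep (γ : ℝ) (t : ℕ → ℤ) (f : ℕ → ℝ) : Prop where
  parity : ∀ k, Even (t (k + 1) - E.a (k + 1))
  fwd : ∀ k, f k = E.tail k * (t (k + 1) + f (k + 1))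
  init : ∃ z : ℤ, 1 + E.tail 0 + f 0 = 2 * (γ - z)

variable {E} {α γ : ℝ} {t : ℕ → ℤ} {f : ℕ → ℝ}

namespace IsExpansionOf

variable (h : E.IsExpansionOf α)
include h

theorem eps_sq (i : ℕ) : (E.ε i : ℝ) * E.ε i = 1 := by
  rcases h.eps_cases i with h | h <;> simp [h]

theorem back_nonneg_le_one (k : ℕ) : 0 ≤ E.back k ∧ E.back k ≤ 1 := by
  induction k with
  | zero => simp [back]
  | succ k ih =>
    have : (1 : ℝ) ≤ E.a (k + 1) + E.ε (k + 1) * E.back k := by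
      have h1 : (1 : ℝ) ≤ E.a (k + 1) := by exact_mod_cast h.one_le_a k
      rcases h.eps_cases (k + 1) with he | he
      · simp only [he]; push_cast; linarith
      · have h2 : (2 : ℝ) ≤ E.a (k + 1) := by exact_mod_cast h.two_le_a k he
        simp only [he]; push_cast; linarith
    exact ⟨by rw [back]; positivity, by rw [back]; exact inv_le_one_of_one_le₀ this⟩

theorem back_nonneg (k : ℕ) : 0 ≤ E.back k := (h.back_nonneg_le_one k).1

theorem back_denom_pos (k : ℕ) : 1 ≤ E.a (k + 1) + E.ε (k + 1) * E.back k := by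
  have h3 := h.back_nonneg_le_one k
  have h1 : (1 : ℝ) ≤ E.a (k + 1) := by exact_mod_cast h.one_le_a k
  rcases h.eps_cases (k + 1) with he | he
  · simp only [he]; push_cast; linarith
  · have h2 : (2 : ℝ) ≤ E.a (k + 1) := by exact_mod_cast h.two_le_a k he
    simp only [he]; push_cast; linarith

theorem back_succ_mul (k : ℕ) :
    E.back (k + 1) * (E.a (k + 1) + E.ε (k + 1) * E.back k) = 1 := by
  have := h.back_denom_pos k
  rw [back]
  exact inv_mul_cancel₀ (by linarith)

theorem back_pos (k : ℕ) : 0 < E.back (k + 1) := by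
  have := h.back_denom_pos k
  rw [back]; positivity

theorem tail_mul (k : ℕ) :
    E.tail k * (E.a (k + 1) + E.ε (k + 2) * E.tail (k + 1)) = 1 := by
  rw [← h.tail_inv]
  exact mul_inv_cancel₀ (h.tail_pos k).ne'

theorem den_pos (k : ℕ) : 0 < E.den k := by
  induction k with
  | zero => simp [den]
  | succ k ih =>
    have := h.back_denom_pos k
    rw [den]; positivity

theorem tailProd_pos (k : ℕ) : 0 < E.tailProd k := by
  induction k with
  | zero => simp [tailProd]
  | succ k ih =>
    have := h.tail_pos k
    rw [tailProd]; positivity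

theorem sgn_sq (k : ℕ) : (E.sgn k : ℝ) * E.sgn k = 1 := by
  induction k with
  | zero => simp [sgn]
  | succ k ih =>
    have := h.eps_sq (k + 1)
    rw [sgn]; push_cast
    linear_combination (E.ε (k + 1) : ℝ) * E.ε (k + 1) * ih + this

/-- The determinant identity of the convergents in product form. It is what converts |X| |Y| into a
multiple of |n| |nα − P − γ|. -/
theorem den_mul_tailProd (k : ℕ) : E.den k * E.tailProd k * E.detFactor k = 1 := by
  induction k with
  | zero => simp [den, tailProd, detFactor, back]
  | succ k ih =>
    have h1 := h.back_succ_mul k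
    have h2 := h.tail_mul k
    rw [detFactor] at ih ⊢
    rw [den, tailProd]
    linear_combination ih + E.den k * E.tailProd k * h2 +
      E.den k * E.tailProd k * E.tail k * E.ε (k + 2) * E.tail (k + 1) * h1

theorem detFactor_pos (k : ℕ) : 0 < E.detFactor k := by
  have h1 := h.den_mul_tailProd k
  have := h.den_pos k
  have := h.tailProd_pos k
  by_contra hc
  have : E.den k * E.tailProd k * E.detFactor k ≤ 0 :=
    mul_nonpos_of_nonneg_of_nonpos (by positivity) (not_lt.1 hc)
  linarith

end IsExpansionOf

/-- Every pair of odd coordinates at level `k` comes from a point of the grid. -/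
theorem IsDigitRep.exists_point (h : E.IsExpansionOf α) (hr : E.IsDigitRep γ t f) (k : ℕ)
    (m l : ℤ) (hm : Odd m) (hl : Odd l) :
    ∃ n P : ℤ, E.sgn k * (2 * n : ℝ) = E.den k * (E.backSum t k + m + l * E.back k) ∧
      2 * (n * α - P - γ) = E.tailProd k * (-f k + l - m * E.ε (k + 1) * E.tail k) := by
  induction k generalizing m l with
  | zero =>
    obtain ⟨z, hz⟩ := hr.init
    obtain ⟨i, rfl⟩ := hm
    obtain ⟨j, rfl⟩ := hl
    -- At level 0 the coordinates are m = 1 − 2n (because `backSum` starts at −1) and l = −2(P + z)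
    -- − 1; these are solved for n and P.
    refine ⟨-i, -j - 1 - z, ?_, ?_⟩
    · simp [sgn, den, backSum, back]
    · simp only [h.eps_one, tailProd, zero_add]
      rw [h.tail_zero] at hz ⊢
      push_cast
      linear_combination hz
  | succ k ih =>
    -- The inverse of the step (m, l) ↦ (−l, a l − ε m − t); the parity of t − a keeps the
    -- coordinates odd.
    have hodd : Odd (E.ε (k + 1) * (-E.a (k + 1) * m - l - t (k + 1))) := by
      have h1 : Odd (-E.a (k + 1) * m - l - t (k + 1)) := by
        have := hr.parity k
        simp only [Int.even_sub, ← Int.not_even_iff_odd, even_neg,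
          Int.even_mul] at *
        tauto
      rcases h.eps_cases (k + 1) with he | he <;> rw [he]
      · simpa only [one_mul] using h1
      · simpa only [neg_one_mul] using h1.neg
    obtain ⟨n, P, h1, h2⟩ := ih _ (-m) hodd hm.neg
    have he := h.eps_sq (k + 1)
    have hb := h.back_succ_mul k
    refine ⟨n, P, ?_, ?_⟩
    · rw [sgn, den, backSum]
      push_cast at h1 ⊢
      linear_combination -(E.ε (k + 1) : ℝ) * h1 +
        E.den k * (-l - t (k + 1) + E.ε (k + 1) * E.backSum t k) * hb +
        E.den k * (E.a (k + 1) * m + l + t (k + 1)) * he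
    · rw [h2, tailProd, hr.fwd k]
      push_cast
      have ht := h.tail_mul k
      linear_combination E.tailProd k * m * ht +
        E.tailProd k * E.tail k * (E.a (k + 1) * m + l + t (k + 1)) * he

/-- The coordinates `(m_k, l_k)` of a point of the grid at each level. -/
def coord (E : Expansion) (t : ℕ → ℤ) (m₀ l₀ : ℤ) : ℕ → ℤ × ℤ
  | 0 => (m₀, l₀)
  | k + 1 =>
    (-(coord E t m₀ l₀ k).2,
      E.a (k + 1) * (coord E t m₀ l₀ k).2 - E.ε (k + 1) * (coord E t m₀ l₀ k).1 - t (k + 1))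

/-- The change of coordinates of `exists_point` run forwards: one fixed point (n, P) is followed
through all levels at once, as the descent in `IsDigitRep.le_M` requires. -/
theorem IsDigitRep.exists_coord (h : E.IsExpansionOf α) (hr : E.IsDigitRep γ t f) (n P : ℤ) :
    ∃ m l : ℕ → ℤ, (∀ k, Odd (m k) ∧ Odd (l k)) ∧ (∀ k, m (k + 1) = -l k) ∧
      (∀ k, l (k + 1) = E.a (k + 1) * l k - E.ε (k + 1) * m k - t (k + 1)) ∧
      ∀ k, E.sgn k * (2 * n : ℝ) = E.den k * (E.backSum t k + m k + l k * E.back k) ∧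
      2 * (n * α - P - γ) = E.tailProd k * (-f k + l k - m k * E.ε (k + 1) * E.tail k) := by
  obtain ⟨z, hz⟩ := hr.init
  set C := coord E t (1 - 2 * n) (2 * (-P - z) - 1) with hC
  have hstep : ∀ k, C (k + 1) = (-(C k).2,
      E.a (k + 1) * (C k).2 - E.ε (k + 1) * (C k).1 - t (k + 1)) := fun k => rfl
  refine ⟨fun k => (C k).1, fun k => (C k).2, ?_, fun k => rfl, fun k => rfl,
    ?_⟩
  · intro k
    induction k with
    | zero => exact ⟨⟨-n, by simp [hC, coord]; ring⟩, ⟨-P - z - 1, by simp [hC, coord]; ring⟩⟩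
    | succ k ih =>
      refine ⟨ih.2.neg, ?_⟩
      change Odd (E.a (k + 1) * (C k).2 - E.ε (k + 1) * (C k).1 - t (k + 1))
      simp only at ih
      have hp := hr.parity k
      obtain ⟨h1, h2⟩ := ih
      rcases h.eps_cases (k + 1) with he | he <;> rw [he] <;>
      · simp only [Int.even_sub, ← Int.not_even_iff_odd, even_neg,
          Int.even_mul] at *
        simp only [h1, h2]
        norm_num
        rw [hp, ← Int.not_even_iff_odd]
        tauto
  · intro k
    induction k with
    | zero =>
      constructor
      · simp [sgn, den, backSum, back, hC, coord]
        ring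
      · simp only [h.eps_one, tailProd, zero_add, hC, coord]
        rw [h.tail_zero] at hz ⊢
        push_cast
        linear_combination hz
    | succ k ih =>
      obtain ⟨h1, h2⟩ := ih
      simp only [hstep]
      have he := h.eps_sq (k + 1)
      have hb := h.back_succ_mul k
      constructor
      · rw [sgn, den, backSum]
        push_cast at h1 ⊢
        linear_combination -(E.ε (k + 1) : ℝ) * h1 +
          E.den k * (-((E.a (k + 1) : ℝ) * (C k).2 - E.ε (k + 1) * (C k).1 - t (k + 1)) - t (k + 1)
            + E.ε (k + 1) * E.backSum t k) * hb
      · rw [h2, tailProd, hr.fwd k]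
        push_cast
        have ht := h.tail_mul k
        linear_combination -E.tailProd k * (C k).2 * ht

end Expansion

/-! ### Normalised products and the vertices of large level -/

theorem distInt_le (x : ℝ) (z : ℤ) : distInt x ≤ |x - z| := round_le x z

theorem distInt_pos {α γ : ℝ} (hγ : ∀ m n : ℤ, γ ≠ m + n * α) (n : ℤ) :
    0 < distInt (n * α - γ) := by
  refine abs_pos.2 fun h0 => hγ (-round (n * α - γ)) n ?_
  push_cast
  linarith

namespace Expansion

variable {E : Expansion} {α γ : ℝ} {t : ℕ → ℤ} {f : ℕ → ℝ}

/-- The normalised first coordinate of a grid point. -/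
def gridX (E : Expansion) (t : ℕ → ℤ) (k : ℕ) (m l : ℝ) : ℝ :=
  E.backSum t k + m + l * E.back k

/-- The normalised second coordinate of a grid point. -/
def gridY (E : Expansion) (f : ℕ → ℝ) (k : ℕ) (m l : ℝ) : ℝ :=
  -f k + l - m * E.ε (k + 1) * E.tail k

namespace IsExpansionOf

variable (h : E.IsExpansionOf α)
include h

/-- The product `|n| |n α - P - γ|` in terms of the normalised coordinates. -/
theorem abs_mul_abs_eq {n P : ℤ} {k : ℕ} {X Y : ℝ}
    (h1 : E.sgn k * (2 * n : ℝ) = E.den k * X) (h2 : 2 * (n * α - P - γ) = E.tailProd k * Y) :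
    4 * (|(n : ℝ)| * |n * α - P - γ|) * E.detFactor k = |X| * |Y| := by
  have hs : |(E.sgn k : ℝ)| = 1 := by
    have := h.sgn_sq k
    rw [← abs_mul_abs_self] at this
    nlinarith [abs_nonneg (E.sgn k : ℝ)]
  have h3 : 2 * |(n : ℝ)| = E.den k * |X| := by
    have := congrArg abs h1
    rwa [abs_mul, hs, abs_mul, abs_mul, abs_of_pos (h.den_pos k), one_mul, abs_two] at this
  have h4 : 2 * |n * α - P - γ| = E.tailProd k * |Y| := by
    have := congrArg abs h2
    rwa [abs_mul, abs_mul, abs_of_pos (h.tailProd_pos k), abs_two] at this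
  have h5 := h.den_mul_tailProd k
  linear_combination 2 * |n * α - P - γ| * E.detFactor k * h3 +
    E.den k * |X| * E.detFactor k * h4 + |X| * |Y| * h5

theorem tail_le {θ A : ℝ} {k : ℕ} (ha : A ≤ E.a (k + 1)) (hθ : E.tail (k + 1) ≤ θ)
    (hA : θ < A) : E.tail k ≤ (A - θ)⁻¹ := by
  have h1 := h.tail_inv k
  have h2 := h.tail_pos (k + 1)
  have : A - θ ≤ (E.tail k)⁻¹ := by
    rw [h1]
    rcases h.eps_cases (k + 2) with he | he <;> rw [he] <;> push_cast <;> linarith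
  exact (le_inv_comm₀ (by linarith) (h.tail_pos k)).1 this

theorem back_le {θ A : ℝ} {k : ℕ} (ha : A ≤ E.a (k + 1)) (hθ : E.back k ≤ θ)
    (hA : θ < A) : E.back (k + 1) ≤ (A - θ)⁻¹ := by
  have h2 := h.back_nonneg k
  rw [back]
  refine inv_anti₀ (by linarith) ?_
  rcases h.eps_cases (k + 1) with he | he <;> rw [he] <;> push_cast <;> linarith

theorem eventually_tail_back_le {θ A : ℝ} (ha : ∀ᶠ i in atTop, A ≤ (E.a i : ℝ))
    (hθ : ∀ᶠ k in atTop, E.tail k ≤ θ ∧ E.back k ≤ θ) (hA : θ < A) :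
    ∀ᶠ k in atTop, E.tail k ≤ (A - θ)⁻¹ ∧ E.back k ≤ (A - θ)⁻¹ := by
  obtain ⟨K, hK⟩ := eventually_atTop.1 (ha.and hθ)
  refine eventually_atTop.2 ⟨K + 1, fun k hk => ?_⟩
  obtain ⟨k, rfl⟩ : ∃ j, k = j + 1 := ⟨k - 1, by omega⟩
  exact ⟨h.tail_le (hK _ (by omega)).1 (hK _ (by omega)).2.1 hA,
    h.back_le (hK _ (by omega)).1 (hK k (by omega)).2.2 hA⟩

/-- From the trivial bound 1, two rounds of θ ↦ 1/(4 − θ) give 1/3 and then 3/11. -/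
theorem eventually_le_three_div_eleven (ha : ∀ᶠ i in atTop, 4 ≤ E.a i) :
    ∀ᶠ k in atTop, E.tail k ≤ 3 / 11 ∧ E.back k ≤ 3 / 11 := by
  have ha' : ∀ᶠ i in atTop, (4 : ℝ) ≤ (E.a i : ℝ) := by
    filter_upwards [ha] with i hi
    exact_mod_cast hi
  have h1 : ∀ᶠ k in atTop, E.tail k ≤ 1 ∧ E.back k ≤ 1 :=
    Eventually.of_forall fun k => ⟨(h.tail_lt_one k).le, (h.back_nonneg_le_one k).2⟩
  have h2 := h.eventually_tail_back_le ha' h1 (by norm_num)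
  have h3 := h.eventually_tail_back_le ha' h2 (by norm_num)
  norm_num at h3
  exact eventually_atTop.2 h3

theorem tendsto_tailProd (hx : ∀ᶠ k in atTop, E.tail k ≤ 1 / 2) :
    Tendsto E.tailProd atTop (nhds 0) := by
  obtain ⟨K, hK⟩ := eventually_atTop.1 hx
  have hle : ∀ j, E.tailProd (j + K) ≤ E.tailProd K * (1 / 2) ^ j := by
    intro j
    induction j with
    | zero => simp
    | succ j ih =>
      have : E.tailProd (j + 1 + K) = E.tailProd (j + K) * E.tail (j + K) := by
        rw [show j + 1 + K = j + K + 1 by ring, tailProd]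
      rw [this, pow_succ, ← mul_assoc]
      exact mul_le_mul ih (hK _ (by omega)) (h.tail_pos _).le
        (mul_nonneg (h.tailProd_pos K).le (by positivity))
  rw [← tendsto_add_atTop_iff_nat K]
  refine squeeze_zero (fun j => (h.tailProd_pos _).le) hle ?_
  simpa using (tendsto_pow_atTop_nhds_zero_of_lt_one (by norm_num : (0 : ℝ) ≤ 1 / 2)
    (by norm_num)).const_mul (E.tailProd K)

end IsExpansionOf

/-- If `c < M α γ`, then all vertices of level `k` give products above `c` for large `k`. -/
theorem IsDigitRep.eventually_lt_vertex (h : E.IsExpansionOf α) (hr : E.IsDigitRep γ t f)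
    (hx : ∀ᶠ k in atTop, E.tail k ≤ 1 / 2) (hf : ∀ k, |f k| ≤ 2)
    (hγ : ∀ m n : ℤ, γ ≠ m + n * α) {c : ℝ} (hc : (c : EReal) < M α γ) :
    ∀ᶠ k in atTop, ∀ m l : ℝ, (m = 1 ∨ m = -1) → (l = 1 ∨ l = -1) →
      4 * c * E.detFactor k < |E.gridX t k m l| * |E.gridY f k m l| := by
  have hfin := eventually_lt_of_lt_liminf hc
  rw [eventually_cofinite] at hfin
  -- The finitely many n with product at most c have ‖nα − γ‖ ≥ δ > 0, since γ ∉ ℤ + αℤ. Vertices of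
  -- large level are closer than δ, so none of these n occurs there.
  obtain ⟨δ, hδ, hδF⟩ : ∃ δ > 0, ∀ n ∈ {n : ℤ | ¬ (c : EReal) <
      ((|(n : ℝ)| * distInt (n * α - γ) : ℝ) : EReal)}, δ ≤ distInt (n * α - γ) := by
    obtain ⟨F, hF⟩ := hfin.exists_finset_coe
    rw [← hF]
    clear hF
    induction F using Finset.induction_on with
    | empty => exact ⟨1, one_pos, by simp⟩
    | insert n F _ ih =>
      obtain ⟨δ, hδ, h1⟩ := ih
      refine ⟨min δ (distInt (n * α - γ)), lt_min hδ (distInt_pos hγ n), fun i hi => ?_⟩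
      rcases Finset.mem_insert.1 (Finset.mem_coe.1 hi) with rfl | hi
      · exact min_le_right _ _
      · exact (min_le_left _ _).trans (h1 i hi)
  have hlim := (h.tendsto_tailProd hx).eventually (gt_mem_nhds (show (0 : ℝ) < δ / 2 by linarith))
  filter_upwards [hlim] with k hk m l hm hl
  obtain ⟨m', hm', hmo⟩ : ∃ m' : ℤ, (m' : ℝ) = m ∧ Odd m' := by
    rcases hm with rfl | rfl
    · exact ⟨1, by simp, odd_one⟩
    · exact ⟨-1, by simp, odd_one.neg⟩
  obtain ⟨l', hl', hlo⟩ : ∃ l' : ℤ, (l' : ℝ) = l ∧ Odd l' := by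
    rcases hl with rfl | rfl
    · exact ⟨1, by simp, odd_one⟩
    · exact ⟨-1, by simp, odd_one.neg⟩
  obtain ⟨n, P, h1, h2⟩ := hr.exists_point h k m' l' hmo hlo
  rw [hm', hl'] at h1 h2
  have h3 := h.abs_mul_abs_eq h1 h2
  -- With |Y| ≤ 4 the distance at a vertex is at most 2 `tailProd k` < δ.
  have hY : |E.gridY f k m l| ≤ 4 := by
    rw [gridY]
    have e1 := h.tail_lt_one k
    have e2 := h.tail_pos k
    have e3 := abs_le.1 (hf k)
    rcases h.eps_cases (k + 1) with he | he <;> rw [he] <;> rcases hm with rfl | rfl <;>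
      rcases hl with rfl | rfl <;> push_cast <;> rw [abs_le] <;> constructor <;> linarith
  have hd : |n * α - P - γ| < δ := by
    have e4 : 2 * |n * α - P - γ| = E.tailProd k * |E.gridY f k m l| := by
      have := congrArg abs h2
      rwa [abs_mul, abs_mul, abs_of_pos (h.tailProd_pos k), abs_two] at this
    nlinarith [h.tailProd_pos k]
  have hdist : distInt (n * α - γ) ≤ |n * α - P - γ| := by
    have := distInt_le (n * α - γ) P
    rwa [sub_right_comm] at this
  have hn : (c : EReal) < ((|(n : ℝ)| * distInt (n * α - γ) : ℝ) : EReal) := by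
    by_contra hcon
    exact absurd (hδF n hcon) (not_le.2 (hdist.trans_lt hd))
  have hlt : c < |(n : ℝ)| * |n * α - P - γ| :=
    (EReal.coe_lt_coe_iff.1 hn).trans_le (mul_le_mul_of_nonneg_left hdist (abs_nonneg _))
  rw [gridX, gridY, ← h3]
  exact mul_lt_mul_of_pos_right (by linarith) (h.detFactor_pos k)

end Expansion

/-! ### Upper bound: large vertices force small digits -/

/-- The excess of u over the fixed point s/(1 − ρ) is bounded by a geometric sequence, and B lies
strictly above that fixed point. -/
theorem eventually_le_of_affine_recursion {u : ℕ → ℝ} {ρ s B : ℝ} (hρ0 : 0 ≤ ρ) (hρ1 : ρ < 1)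
    (hu : ∀ᶠ k in atTop, u (k + 1) ≤ ρ * u k + s) (hB : s < (1 - ρ) * B) :
    ∀ᶠ k in atTop, u k ≤ B := by
  obtain ⟨K, hK⟩ := eventually_atTop.1 hu
  have hr : 0 < 1 - ρ := by linarith
  set B₀ := s / (1 - ρ) with hB₀
  have hs : s = (1 - ρ) * B₀ := by rw [hB₀]; field_simp
  have hBB : 0 < B - B₀ := by
    rw [hs] at hB
    have := lt_of_mul_lt_mul_left hB hr.le
    linarith
  have hle : ∀ j, u (K + j) - B₀ ≤ ρ ^ j * |u K - B₀| := by
    intro j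
    induction j with
    | zero => simpa using le_abs_self (u K - B₀)
    | succ j ih =>
      have h1 := hK (K + j) (by omega)
      have h2 := mul_le_mul_of_nonneg_left ih hρ0
      rw [← add_assoc, pow_succ]
      nlinarith
  have hlim : Tendsto (fun j => ρ ^ j * |u K - B₀|) atTop (nhds 0) := by
    simpa using (tendsto_pow_atTop_nhds_zero_of_lt_one hρ0 hρ1).mul_const (|u K - B₀|)
  obtain ⟨J, hJ⟩ := eventually_atTop.1 (hlim.eventually (gt_mem_nhds hBB))
  refine eventually_atTop.2 ⟨K + J, fun k hk => ?_⟩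
  obtain ⟨j, rfl⟩ := Nat.exists_eq_add_of_le hk
  have h1 := hle (J + j)
  have h2 := hJ (J + j) (by omega)
  rw [← add_assoc] at h1
  linarith

/-- Two neighbouring points cannot both have large products if one coordinate is small. -/
theorem not_both_products_large {X p q κ : ℝ} (hX0 : -(19 / 25) ≤ X) (hX1 : X ≤ 69 / 25)
    (hp : 0 ≤ p) (hpq : p ≤ q) (hq : q ≤ 6 / 11) (hκ : 333 / 1000 ≤ κ)
    (h1 : κ < |X| * p) (h2 : κ < |X - 2| * (q - p)) : False := by
  -- Outside [0, 2] one of |X|, |X − 2| is at most 19/25 and the other at most 69/25, while 0.333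
  -- (25/19 + 25/69) > 6/11 ≥ q.
  rcases le_total X 0 with hX | hX
  · rw [abs_of_nonpos hX] at h1
    rw [abs_of_nonpos (by linarith)] at h2
    nlinarith [mul_le_mul_of_nonneg_right (show -X ≤ 19 / 25 by linarith) hp,
      mul_le_mul_of_nonneg_right (show -(X - 2) ≤ 69 / 25 by linarith) (sub_nonneg.2 hpq)]
  rw [abs_of_nonneg hX] at h1
  rcases le_total X 2 with hX' | hX'
  -- For 0 ≤ X ≤ 2 multiply the two inequalities: X(2 − X) ≤ 1 and p(q − p) ≤ (3/11)² by AM–GM, and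
  -- (3/11)² < κ².
  · rw [abs_of_nonpos (by linarith)] at h2
    have h3 : κ * κ < X * p * (-(X - 2) * (q - p)) :=
      mul_lt_mul'' h1 h2 (by linarith) (by linarith)
    have h4 : X * -(X - 2) ≤ 1 := by nlinarith [sq_nonneg (X - 1)]
    have h5 : p * (q - p) ≤ (3 / 11) ^ 2 := by nlinarith [sq_nonneg (p - (q - p))]
    have h6 : X * p * (-(X - 2) * (q - p)) ≤ 1 * (3 / 11) ^ 2 := by
      calc X * p * (-(X - 2) * (q - p)) = (X * -(X - 2)) * (p * (q - p)) := by ring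
        _ ≤ 1 * (3 / 11) ^ 2 :=
          mul_le_mul h4 h5 (mul_nonneg hp (sub_nonneg.2 hpq)) (by norm_num)
    nlinarith
  · rw [abs_of_nonneg (by linarith)] at h2
    nlinarith [mul_le_mul_of_nonneg_right hX1 hp,
      mul_le_mul_of_nonneg_right (show X - 2 ≤ 19 / 25 by linarith) (sub_nonneg.2 hpq)]

/-- Bound for the number of steps between the two end vertices of a row. -/
theorem lt_of_row_products {a b w z κ : ℝ} (ha : 4 ≤ a) (hb : 2 ≤ b) (hba : b ≤ a)
    (hw : |w| ≤ 21 / 20) (hz : |z| ≤ 1) (hκ : 9 / 25 * (a - 6 / 11) ≤ κ)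
    (h1 : κ < |w + 1| * |b + z - 1|) (h2 : κ < |w - 1| * |b + z + 1|)
    (h3 : κ < |b + w - 1| * |z + 1|) (h4 : κ < |b + w + 1| * |z - 1|) : κ < b := by
  rw [abs_le] at hw hz
  have hz1 : 0 ≤ b + z - 1 := by linarith
  rw [abs_of_nonneg hz1] at h1
  rw [abs_of_nonneg (show 0 ≤ b + z + 1 by linarith)] at h2
  -- If |w| exceeds 1, by at most 1/20, one of the first two products is at most (b + 2)/20, far
  -- below 9/25 (a − 6/11).
  rcases lt_or_ge w (-1) with hw1 | hw1
  · rw [abs_of_neg (by linarith)] at h1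
    nlinarith [mul_le_mul_of_nonneg_right (show -(w + 1) ≤ 1 / 20 by linarith) hz1]
  rcases lt_or_ge 1 w with hw2 | hw2
  · rw [abs_of_pos (by linarith)] at h2
    nlinarith [mul_le_mul_of_nonneg_right (show w - 1 ≤ 1 / 20 by linarith)
      (show 0 ≤ b + z + 1 by linarith)]
  rw [abs_of_nonneg (by linarith)] at h1
  rw [abs_of_nonpos (by linarith)] at h2
  rw [abs_of_nonneg (by linarith), abs_of_nonneg (by linarith)] at h3
  rw [abs_of_nonneg (by linarith), abs_of_nonpos (by linarith)] at h4
  -- The four products now sum to 4b, as w and z cancel.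
  nlinarith

namespace Expansion

variable {E : Expansion} {α γ : ℝ} {t : ℕ → ℤ} {f : ℕ → ℝ}

/-- The excess of the backward sum over its natural range. -/
def overflow (E : Expansion) (t : ℕ → ℤ) (k : ℕ) : ℝ :=
  max (max (E.backSum t k - 1 - E.ε (k + 1) * E.back k)
    (-E.backSum t k - 1 + E.ε (k + 1) * E.back k)) 0

/-- Only the a priori range of the digits enters. Since the backward tails are eventually at most
3/11, the recursion contracts and supplies the crude control of the backward sum that `abs_fwd_lt`
needs. -/
theorem overflow_succ_le (h : E.IsExpansionOf α) {k : ℕ}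
    (ht0 : -E.a (k + 1) + 1 - E.ε (k + 1) ≤ t (k + 1))
    (ht1 : t (k + 1) ≤ E.a (k + 1) - E.ε (k + 1) + E.ε (k + 2)) :
    E.overflow t (k + 1) ≤ E.back (k + 1) * (2 + E.overflow t k) := by
  have hb := h.back_succ_mul k
  have hy := h.back_pos k
  have hy0 := h.back_nonneg_le_one k
  have ht0' : -(E.a (k + 1) : ℝ) + 1 - E.ε (k + 1) ≤ t (k + 1) := by exact_mod_cast ht0
  have ht1' : (t (k + 1) : ℝ) ≤ E.a (k + 1) - E.ε (k + 1) + E.ε (k + 2) := by exact_mod_cast ht1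
  have o1 : E.backSum t k - 1 - E.ε (k + 1) * E.back k ≤ E.overflow t k :=
    (le_max_left _ _).trans (le_max_left _ _)
  have o2 : -E.backSum t k - 1 + E.ε (k + 1) * E.back k ≤ E.overflow t k :=
    (le_max_right _ _).trans (le_max_left _ _)
  have o3 : 0 ≤ E.overflow t k := le_max_right _ _
  generalize E.overflow t k = o at *
  rw [overflow, show E.backSum t (k + 1) =
    E.back (k + 1) * (t (k + 1) - E.ε (k + 1) * E.backSum t k) from rfl]
  refine max_le (max_le ?_ ?_) (by positivity)
  · have : t (k + 1) - E.ε (k + 1) * E.backSum t k - (E.a (k + 1) + E.ε (k + 1) * E.back k)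
        - E.ε (k + 2) ≤ 2 + o := by
      rcases h.eps_cases (k + 1) with he | he <;> simp only [he] at o1 o2 ht0' ht1' ⊢ <;> push_cast at * <;> linarith
    have h2 := mul_le_mul_of_nonneg_left this hy.le
    have h3 : k + 1 + 1 = k + 2 := rfl
    rw [h3]
    linarith
  · have : -(t (k + 1) - E.ε (k + 1) * E.backSum t k) - (E.a (k + 1) + E.ε (k + 1) * E.back k)
        + E.ε (k + 2) ≤ 2 + o := by
      rcases h.eps_cases (k + 1) with he | he <;> rcases h.eps_cases (k + 2) with he' | he' <;>
        simp only [he, he'] at o1 o2 ht0' ht1' ⊢ <;> push_cast at * <;> linarith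
    have h2 := mul_le_mul_of_nonneg_left this hy.le
    have h3 : k + 1 + 1 = k + 2 := rfl
    rw [h3]
    linarith

theorem tail_denom_pos (h : E.IsExpansionOf α) (k : ℕ) :
    0 < E.a (k + 1) + E.ε (k + 2) * E.tail (k + 1) := by
  rw [← h.tail_inv]
  exact inv_pos.2 (h.tail_pos k)

/-- Scaling level k by 1/α_k and level k + 1 by q_{k+1}/q_k turns both determinant factors into the
same W = a + ε_{k+2} α_{k+1} + ε_{k+1} q_{k−1}/q_k, so that vertices of the two levels become
comparable. -/
theorem detFactor_mul_fwd (h : E.IsExpansionOf α) (k : ℕ) :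
    E.detFactor k * (E.a (k + 1) + E.ε (k + 2) * E.tail (k + 1)) =
      E.a (k + 1) + E.ε (k + 2) * E.tail (k + 1) + E.ε (k + 1) * E.back k := by
  rw [detFactor]
  linear_combination E.ε (k + 1) * E.back k * h.tail_mul k

theorem detFactor_mul_back (h : E.IsExpansionOf α) (k : ℕ) :
    E.detFactor (k + 1) * (E.a (k + 1) + E.ε (k + 1) * E.back k) =
      E.a (k + 1) + E.ε (k + 2) * E.tail (k + 1) + E.ε (k + 1) * E.back k := by
  rw [detFactor]
  linear_combination E.ε (k + 2) * E.tail (k + 1) * h.back_succ_mul k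

theorem abs_gridX_mul_abs_gridY_mul_fwd (h : E.IsExpansionOf α) (hr : E.IsDigitRep γ t f) (k : ℕ)
    (m l : ℝ) :
    |E.gridX t k m l| * |E.gridY f k m l| * (E.a (k + 1) + E.ε (k + 2) * E.tail (k + 1)) =
      |E.backSum t k + m + l * E.back k| * |-(t (k + 1) + f (k + 1))
        + l * (E.a (k + 1) + E.ε (k + 2) * E.tail (k + 1)) - m * E.ε (k + 1)| := by
  have e2 : E.gridY f k m l * (E.a (k + 1) + E.ε (k + 2) * E.tail (k + 1)) =
      -(t (k + 1) + f (k + 1)) + l * (E.a (k + 1) + E.ε (k + 2) * E.tail (k + 1))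
        - m * E.ε (k + 1) := by
    rw [gridY, hr.fwd k]
    linear_combination -(t (k + 1) + f (k + 1) + m * E.ε (k + 1)) * h.tail_mul k
  rw [← e2, abs_mul (E.gridY f k m l), abs_of_pos (tail_denom_pos h k), mul_assoc]
  rfl

theorem abs_gridX_mul_abs_gridY_mul_back (h : E.IsExpansionOf α) (k : ℕ) (m l : ℝ) :
    |E.gridX t (k + 1) m l| * |E.gridY f (k + 1) m l| *
        (E.a (k + 1) + E.ε (k + 1) * E.back k) =
      |t (k + 1) - E.ε (k + 1) * E.backSum t k + m * (E.a (k + 1) + E.ε (k + 1) * E.back k) + l|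
        * |-f (k + 1) + l - m * E.ε (k + 2) * E.tail (k + 1)| := by
  have e2 : E.gridX t (k + 1) m l * (E.a (k + 1) + E.ε (k + 1) * E.back k) =
      t (k + 1) - E.ε (k + 1) * E.backSum t k + m * (E.a (k + 1) + E.ε (k + 1) * E.back k)
        + l := by
    rw [gridX, backSum]
    linear_combination (t (k + 1) - E.ε (k + 1) * E.backSum t k + l) * h.back_succ_mul k
  rw [← e2, abs_mul (E.gridX t (k + 1) m l),
    abs_of_nonneg (zero_le_one.trans (h.back_denom_pos k)), mul_right_comm]
  rfl

section Row

variable (h : E.IsExpansionOf α) (hr : E.IsDigitRep γ t f) {k : ℕ} {c : ℝ}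
include h

theorem detFactor_mem (hx : E.tail k ≤ 3 / 11) (hy : E.back k ≤ 3 / 11) :
    925 / 1000 ≤ E.detFactor k := by
  have h1 := h.tail_pos k
  have h2 := h.back_nonneg k
  have h3 := mul_le_mul hx hy h2 (by norm_num)
  have h4 := mul_nonneg h1.le h2
  rw [detFactor]
  rcases h.eps_cases (k + 1) with he | he <;> rw [he] <;> push_cast <;> linarith

/-- The forward sums stay away from the ends of their range. -/
theorem abs_fwd_lt (hc : 9 / 25 ≤ 4 * c)
    (hf0 : -1 - E.ε (k + 1) * E.tail k ≤ f k) (hf1 : f k < 1 - E.ε (k + 1) * E.tail k)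
    (hx : E.tail k ≤ 3 / 11) (hy : E.back k ≤ 3 / 11) (ho : E.overflow t k ≤ 19 / 25)
    (hv : ∀ m l : ℝ, (m = 1 ∨ m = -1) → (l = 1 ∨ l = -1) →
      4 * c * E.detFactor k < |E.gridX t k m l| * |E.gridY f k m l|) :
    |f k| < 1 - E.tail k := by
  have hx0 := h.tail_pos k
  have hy0 := h.back_nonneg k
  have hκ : 333 / 1000 ≤ 4 * c * E.detFactor k := by
    nlinarith [detFactor_mem h hx hy]
  have o1 : E.backSum t k - 1 - E.ε (k + 1) * E.back k ≤ 19 / 25 :=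
    ((le_max_left _ _).trans (le_max_left _ _)).trans ho
  have o2 : -E.backSum t k - 1 + E.ε (k + 1) * E.back k ≤ 19 / 25 :=
    ((le_max_right _ _).trans (le_max_left _ _)).trans ho
  generalize 4 * c * E.detFactor k = κ at *
  simp only [gridX, gridY] at hv
  -- For ε = 1 only the lower end of the range of f violates |f| < 1 − x; for ε = −1 the upper end
  -- does, apart from one boundary value. In the excess interval two vertices with the same l have
  -- |Y| equal to p and 2x − p, while their X differ by 2, so `not_both_products_large` applies.
  rcases h.eps_cases (k + 1) with he | he
  · simp only [he, Int.cast_one, one_mul, mul_one] at *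
    refine abs_lt.2 ⟨?_, hf1⟩
    by_contra hcon
    have v1 := hv 1 (-1) (Or.inl rfl) (Or.inr rfl)
    have v2 := hv (-1) (-1) (Or.inr rfl) (Or.inr rfl)
    refine not_both_products_large (X := E.backSum t k + 1 - E.back k) (p := f k + 1 + E.tail k)
      (q := 2 * E.tail k) (by linarith) (by linarith) (by linarith) (by linarith) (by linarith)
      hκ ?_ ?_
    · rw [show -f k + -1 - 1 * E.tail k = -(f k + 1 + E.tail k) by ring, abs_neg,
        abs_of_nonneg (show 0 ≤ f k + 1 + E.tail k by linarith)] at v1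
      convert v1 using 3
      ring
    · rw [abs_of_nonneg (show 0 ≤ -f k + -1 - -1 * E.tail k by linarith)] at v2
      convert v2 using 2
      · congr 1; ring
      · ring
  · simp only [he, Int.cast_neg, Int.cast_one] at *
    rw [abs_lt]
    constructor
    -- The boundary value f = −1 + x would give Y = 0 at the vertex (1, −1).
    · have v1 := hv 1 (-1) (Or.inl rfl) (Or.inr rfl)
      rcases eq_or_lt_of_le hf0 with h0 | h0
      · rw [← h0] at v1
        rw [show -(-1 - -1 * E.tail k) + -1 - 1 * -1 * E.tail k = 0 by ring, abs_zero,
          mul_zero] at v1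
        linarith
      · linarith
    · by_contra hcon
      have v1 := hv 1 1 (Or.inl rfl) (Or.inl rfl)
      have v2 := hv (-1) 1 (Or.inr rfl) (Or.inl rfl)
      refine not_both_products_large (X := E.backSum t k + 1 + E.back k) (p := 1 + E.tail k - f k)
        (q := 2 * E.tail k) (by linarith) (by linarith) (by linarith) (by linarith) (by linarith)
        hκ ?_ ?_
      · rw [show -f k + 1 - 1 * -1 * E.tail k = 1 + E.tail k - f k by ring,
          abs_of_nonneg (show 0 ≤ 1 + E.tail k - f k by linarith)] at v1
        convert v1 using 3
        ring
      · rw [show -f k + 1 - -1 * -1 * E.tail k = -(2 * E.tail k - (1 + E.tail k - f k)) by ring,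
          abs_neg,
          abs_of_nonneg (show 0 ≤ 2 * E.tail k - (1 + E.tail k - f k) by linarith)] at v2
        convert v2 using 3
        ring

include hr

/-- Dividing |f_k| < 1 − α_k by α_k, whose inverse is a + ε α_{k+1}, gives |t| < a; the parity t ≡ a
mod 2 improves this to a − 2. -/
theorem abs_digit_le (h0 : |f k| < 1 - E.tail k) (h1 : |f (k + 1)| < 1 - E.tail (k + 1)) :
    |t (k + 1)| ≤ E.a (k + 1) - 2 := by
  have hx := h.tail_pos k
  have hx' := h.tail_pos (k + 1)
  have ht := h.tail_mul k
  have hlt : |(t (k + 1) : ℝ)| < E.a (k + 1) := by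
    rw [hr.fwd k, abs_mul, abs_of_pos hx] at h0
    have h2 : |(t (k + 1) : ℝ) + f (k + 1)| < E.a (k + 1) + E.ε (k + 2) * E.tail (k + 1) - 1 := by
      refine lt_of_mul_lt_mul_left (a := E.tail k) ?_ hx.le
      linarith
    rw [abs_lt] at *
    rcases h.eps_cases (k + 2) with he | he <;> rw [he] at h2 <;> push_cast at h2 <;>
      constructor <;> linarith
  have hlt' : |t (k + 1)| < E.a (k + 1) := by exact_mod_cast hlt
  obtain ⟨i, hi⟩ := hr.parity k
  rw [abs_lt] at hlt'
  rw [abs_le]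
  constructor <;> omega

/-- The row is l = 1 if t ≥ 0 and l = −1 if t ≤ 0. With M = l ε m and b = a − |t|, the scaled
product along it is |w + M| |b + z − M|; M = ±1 are vertices of level k and M = b ± 1 are vertices
of level k + 1, so `lt_of_row_products` applies. -/
theorem lt_sub_abs_digit (hc : 9 / 25 ≤ 4 * c) (ha : 4 ≤ E.a (k + 1))
    (ht : |t (k + 1)| ≤ E.a (k + 1) - 2)
    (hx : E.tail (k + 1) ≤ 3 / 11) (hy : E.back k ≤ 3 / 11)
    (hf : |f (k + 1)| < 1 - E.tail (k + 1)) (hb : |E.backSum t k| ≤ 1 - E.back k + 1 / 20)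
    (hv : ∀ m l : ℝ, (m = 1 ∨ m = -1) → (l = 1 ∨ l = -1) →
      4 * c * E.detFactor k < |E.gridX t k m l| * |E.gridY f k m l|)
    (hv' : ∀ m l : ℝ, (m = 1 ∨ m = -1) → (l = 1 ∨ l = -1) →
      4 * c * E.detFactor (k + 1) < |E.gridX t (k + 1) m l| * |E.gridY f (k + 1) m l|) :
    4 * c * (E.a (k + 1) + E.ε (k + 2) * E.tail (k + 1) + E.ε (k + 1) * E.back k)
      < E.a (k + 1) - |(t (k + 1) : ℝ)| := by
  have ha' : (4 : ℝ) ≤ E.a (k + 1) := by exact_mod_cast ha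
  have ht' : |(t (k + 1) : ℝ)| ≤ E.a (k + 1) - 2 := by exact_mod_cast ht
  have hx1 := h.tail_pos (k + 1)
  have hy0 := h.back_nonneg k
  have row1 : ∀ m l : ℝ, (m = 1 ∨ m = -1) → (l = 1 ∨ l = -1) →
      4 * c * (E.a (k + 1) + E.ε (k + 2) * E.tail (k + 1) + E.ε (k + 1) * E.back k) <
      |E.backSum t k + m + l * E.back k| * |-(t (k + 1) + f (k + 1))
        + l * (E.a (k + 1) + E.ε (k + 2) * E.tail (k + 1)) - m * E.ε (k + 1)| := by
    intro m l hm hl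
    have hv1 := mul_lt_mul_of_pos_right (hv m l hm hl) (tail_denom_pos h k)
    rwa [abs_gridX_mul_abs_gridY_mul_fwd h hr, mul_assoc, detFactor_mul_fwd h] at hv1
  have row2 : ∀ m l : ℝ, (m = 1 ∨ m = -1) → (l = 1 ∨ l = -1) →
      4 * c * (E.a (k + 1) + E.ε (k + 2) * E.tail (k + 1) + E.ε (k + 1) * E.back k) <
      |t (k + 1) - E.ε (k + 1) * E.backSum t k + m * (E.a (k + 1) + E.ε (k + 1) * E.back k) + l|
        * |-f (k + 1) + l - m * E.ε (k + 2) * E.tail (k + 1)| := by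
    intro m l hm hl
    have hv1 := mul_lt_mul_of_pos_right (hv' m l hm hl) (zero_lt_one.trans_le (h.back_denom_pos k))
    rwa [abs_gridX_mul_abs_gridY_mul_back h, mul_assoc, detFactor_mul_back h] at hv1
  have hκ : 9 / 25 * (E.a (k + 1) - 6 / 11 : ℝ) ≤
      4 * c * (E.a (k + 1) + E.ε (k + 2) * E.tail (k + 1) + E.ε (k + 1) * E.back k) := by
    refine mul_le_mul hc ?_ (by linarith) (by linarith)
    rcases h.eps_cases (k + 1) with he | he <;> rcases h.eps_cases (k + 2) with he' | he' <;>
      rw [he, he'] <;> push_cast <;> linarith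
  have hε := h.eps_cases (k + 1)
  have hε' := h.eps_cases (k + 2)
  have hεr : (E.ε (k + 1) : ℝ) = 1 ∨ (E.ε (k + 1) : ℝ) = -1 := by
    rcases hε with he | he <;> simp [he]
  have hεr' : (E.ε (k + 2) : ℝ) = 1 ∨ (E.ε (k + 2) : ℝ) = -1 := by
    rcases hε' with he | he <;> simp [he]
  clear hv hv'
  generalize 4 * c * (E.a (k + 1) + E.ε (k + 2) * E.tail (k + 1) + E.ε (k + 1) * E.back k) = κ at *
  generalize (E.ε (k + 1) : ℝ) = e at *
  generalize (E.ε (k + 2) : ℝ) = e' at *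
  generalize E.backSum t k = u at *
  generalize E.back k = y at *
  generalize E.tail (k + 1) = x at *
  generalize f (k + 1) = v at *
  generalize (t (k + 1) : ℝ) = s at *
  generalize (E.a (k + 1) : ℝ) = a at *
  clear hε hε' ht ha
  have he1 : |e| = 1 := by rcases hεr with rfl | rfl <;> simp
  have heneg : (-e = 1 ∨ -e = -1) := by rcases hεr with rfl | rfl <;> simp
  have hee : e * e = 1 := by rcases hεr with rfl | rfl <;> simp
  have hkey : ∀ r : ℝ, |e * r| = |r| := fun r => by rw [abs_mul, he1, one_mul]
  rw [abs_lt] at hf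
  rw [abs_le] at hb
  rcases le_total 0 s with hs | hs
  · rw [abs_of_nonneg hs] at ht' ⊢
    refine lt_of_row_products (w := e * (u + y)) (z := e' * x - v) ha' (by linarith) (by linarith)
      ?_ ?_ hκ ?_ ?_ ?_ ?_
    · rw [abs_mul, he1, one_mul, abs_le]; constructor <;> linarith
    · rw [abs_le]; rcases hεr' with rfl | rfl <;> constructor <;> linarith
    · convert row1 e 1 hεr (Or.inl rfl) using 2
      · rw [← hkey (u + e + 1 * y)]; congr 1; linear_combination -hee
      · congr 1; linear_combination hee
    · convert row1 (-e) 1 heneg (Or.inl rfl) using 2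
      · rw [← hkey (u + -e + 1 * y)]; congr 1; linear_combination hee
      · congr 1; linear_combination -hee
    · convert row2 (-1) 1 (Or.inr rfl) (Or.inl rfl) using 2
      · rw [← abs_neg]; congr 1; ring
      · congr 1; ring
    · convert row2 (-1) (-1) (Or.inr rfl) (Or.inr rfl) using 2
      · rw [← abs_neg]; congr 1; ring
      · congr 1; ring
  · rw [abs_of_nonpos hs] at ht' ⊢
    refine lt_of_row_products (w := e * (-u + y)) (z := e' * x + v) ha' (by linarith) (by linarith)
      ?_ ?_ hκ ?_ ?_ ?_ ?_
    · rw [abs_mul, he1, one_mul, abs_le]; constructor <;> linarith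
    · rw [abs_le]; rcases hεr' with rfl | rfl <;> constructor <;> linarith
    · convert row1 (-e) (-1) heneg (Or.inr rfl) using 2
      · rw [← hkey (u + -e + -1 * y), abs_eq_abs]; right; linear_combination -hee
      · rw [abs_eq_abs]; right; linear_combination hee
    · convert row1 e (-1) hεr (Or.inr rfl) using 2
      · rw [← hkey (u + e + -1 * y), abs_eq_abs]; right; linear_combination hee
      · rw [abs_eq_abs]; right; linear_combination -hee
    · convert row2 1 (-1) (Or.inl rfl) (Or.inr rfl) using 2
      · congr 1; ring
      · rw [← abs_neg]; congr 1; ring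
    · convert row2 1 1 (Or.inl rfl) (Or.inl rfl) using 2
      · congr 1; ring
      · rw [← abs_neg]; congr 1; ring

end Row

/-- The digits of a `γ` with large approximation constant are eventually small. -/
theorem IsDigitRep.eventually_lt_sub_abs_digit (h : E.IsExpansionOf α)
    (hr : E.IsDigitRep γ t f) (ha : ∀ᶠ i in atTop, 4 ≤ E.a i)
    (hγ : ∀ m n : ℤ, γ ≠ m + n * α)
    (hf : ∀ k, -1 - E.ε (k + 1) * E.tail k ≤ f k ∧ f k < 1 - E.ε (k + 1) * E.tail k)
    (ht : ∀ k, -E.a (k + 1) + 1 - E.ε (k + 1) ≤ t (k + 1) ∧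
      t (k + 1) ≤ E.a (k + 1) - E.ε (k + 1) + E.ε (k + 2))
    {c : ℝ} (hc : 9 / 25 ≤ 4 * c) (hM : (c : EReal) < M α γ) :
    ∀ᶠ k in atTop,
      4 * c * (E.a (k + 1) + E.ε (k + 2) * E.tail (k + 1) + E.ε (k + 1) * E.back k)
      < E.a (k + 1) - |(t (k + 1) : ℝ)| := by
  have hxy := h.eventually_le_three_div_eleven ha
  have hf2 : ∀ k, |f k| ≤ 2 := by
    intro k
    have h1 := hf k
    have h2 := h.tail_pos k
    have h3 := h.tail_lt_one k
    rcases h.eps_cases (k + 1) with he | he <;> rw [he] at h1 <;> push_cast at h1 <;>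
      rw [abs_le] <;> constructor <;> linarith
  have hv := hr.eventually_lt_vertex h (hxy.mono fun k hk => by linarith [hk.1]) hf2 hγ hM
  have hov : ∀ᶠ k in atTop, E.overflow t k ≤ 19 / 25 := by
    -- The fixed point of o ↦ (3/11)(2 + o) is 3/4, just below 19/25.
    refine eventually_le_of_affine_recursion (ρ := 3 / 11) (s := 6 / 11) (by norm_num)
      (by norm_num) ?_ (by norm_num)
    filter_upwards [(tendsto_add_atTop_nat 1).eventually hxy] with k hk
    have h1 := overflow_succ_le h (ht k).1 (ht k).2
    have h2 : 0 ≤ E.overflow t k := le_max_right _ _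
    have h3 := mul_le_mul_of_nonneg_right hk.2 (show 0 ≤ 2 + E.overflow t k by linarith)
    linarith
  have hfw : ∀ᶠ k in atTop, |f k| < 1 - E.tail k := by
    filter_upwards [hv, hov, hxy] with k h1 h2 h3
    exact abs_fwd_lt h hc (hf k).1 (hf k).2 h3.1 h3.2 h2 h1
  have hdig : ∀ᶠ k in atTop, |t (k + 1)| ≤ E.a (k + 1) - 2 := by
    filter_upwards [hfw, (tendsto_add_atTop_nat 1).eventually hfw] with k h1 h2
    exact abs_digit_le h hr h1 h2
  have hback : ∀ᶠ k in atTop, max (|E.backSum t k| - (1 - E.back k)) 0 ≤ 1 / 20 := by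
    -- With |t| ≤ a − 2 the excess over 1 − y contracts without additive term, so any positive bound
    -- is reached; 1/20 is the margin allowed by `lt_of_row_products`.
    refine eventually_le_of_affine_recursion (ρ := 3 / 11) (s := 0) (by norm_num)
      (by norm_num) ?_ (by norm_num)
    filter_upwards [(tendsto_add_atTop_nat 1).eventually hxy, hdig] with k h1 h2
    have hm := le_max_left (|E.backSum t k| - (1 - E.back k)) 0
    have hm0 := le_max_right (|E.backSum t k| - (1 - E.back k)) 0
    set o := max (|E.backSum t k| - (1 - E.back k)) 0
    have h2' : |(t (k + 1) : ℝ)| ≤ E.a (k + 1) - 2 := by exact_mod_cast h2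
    have hy := h.back_pos k
    have hy0 := h.back_nonneg k
    have hbm := h.back_succ_mul k
    rw [add_zero]
    refine max_le ?_ (by positivity)
    have h3 : |E.backSum t (k + 1)| ≤
        E.back (k + 1) * (|(t (k + 1) : ℝ)| + |E.backSum t k|) := by
      rw [backSum, abs_mul, abs_of_pos hy]
      refine mul_le_mul_of_nonneg_left ((abs_sub _ _).trans_eq ?_) hy.le
      rw [abs_mul]
      rcases h.eps_cases (k + 1) with he | he <;> simp [he]
    have h4 : |(t (k + 1) : ℝ)| + |E.backSum t k| ≤
        (E.a (k + 1) + E.ε (k + 1) * E.back k) - 1 + o := by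
      rcases h.eps_cases (k + 1) with he | he <;> rw [he] <;> push_cast <;> linarith
    have h5 := mul_le_mul_of_nonneg_left h4 hy.le
    have h6 := mul_le_mul_of_nonneg_right h1.2 hm0
    linarith
  filter_upwards [hv, (tendsto_add_atTop_nat 1).eventually hv, hdig,
    (tendsto_add_atTop_nat 1).eventually hfw, hback, hxy,
    (tendsto_add_atTop_nat 1).eventually hxy, (tendsto_add_atTop_nat 1).eventually ha]
    with k h1 h2 h3 h4 h5 h6 h7 h8
  refine lt_sub_abs_digit h hr hc h8 h3 h7.1 h6.2 h4 ?_ h1 h2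
  have := (le_max_left _ _).trans h5
  linarith

end Expansion

/-! ### Lower bound: every distant grid point is dominated by vertices -/

/-- The products along a row are bounded below by those at its end vertices. -/
theorem le_row_product {b M : ℤ} {w z κ : ℝ} (hb : 2 ≤ b) (hbe : Even b) (hM : Odd M)
    (hw : |w| ≤ 1) (hz : |z| ≤ 1)
    (h1 : κ ≤ |w + 1| * |b + z - 1|) (h2 : κ ≤ |w - 1| * |b + z + 1|)
    (h3 : κ ≤ |b + w - 1| * |z + 1|) (h4 : κ ≤ |b + w + 1| * |z - 1|) :
    κ ≤ |w + M| * |b + z - M| := by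
  rw [abs_le] at hw hz
  have hb' : (2 : ℝ) ≤ b := by exact_mod_cast hb
  rw [abs_of_nonneg (by linarith), abs_of_nonneg (by linarith)] at h1
  rw [abs_of_nonpos (by linarith), abs_of_nonneg (by linarith)] at h2
  rw [abs_of_nonneg (by linarith), abs_of_nonneg (by linarith)] at h3
  rw [abs_of_nonneg (by linarith), abs_of_nonpos (by linarith)] at h4
  obtain ⟨i, hi⟩ := hbe
  obtain ⟨j, hj⟩ := hM
  -- Parity excludes M = 0 and M = b. Outside the interval both factors grow in modulus from M = −1
  -- or M = b + 1; inside, the product is concave in M and is smallest at M = 1 or M = b − 1.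
  have hcases : M ≤ -1 ∨ (1 ≤ M ∧ M ≤ b - 1) ∨ b + 1 ≤ M := by omega
  rcases hcases with hc | ⟨hc1, hc2⟩ | hc
  · have hc' : (M : ℝ) ≤ -1 := by exact_mod_cast hc
    rw [abs_of_nonpos (by linarith), abs_of_nonneg (by linarith)]
    refine h2.trans (mul_le_mul ?_ ?_ ?_ ?_) <;> linarith
  · have hc1' : (1 : ℝ) ≤ M := by exact_mod_cast hc1
    have hc2' : (M : ℝ) ≤ b - 1 := by exact_mod_cast hc2
    rw [abs_of_nonneg (by linarith), abs_of_nonneg (by linarith)]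
    rcases le_total (M + 1 : ℝ) (b + z - w) with hd | hd
    · nlinarith [mul_nonneg (show (0 : ℝ) ≤ M - 1 by linarith)
        (show (0 : ℝ) ≤ b + z - w - M - 1 by linarith)]
    · nlinarith [mul_nonneg (show (0 : ℝ) ≤ b - 1 - M by linarith)
        (show (0 : ℝ) ≤ M + b - 1 - (b + z - w) by linarith)]
  · have hc' : (b + 1 : ℝ) ≤ M := by exact_mod_cast hc
    rw [abs_of_nonneg (by linarith), abs_of_nonpos (by linarith)]
    refine h4.trans (mul_le_mul ?_ ?_ ?_ ?_) <;> linarith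

namespace Expansion

variable {E : Expansion} {α γ : ℝ} {t : ℕ → ℤ} {f : ℕ → ℝ}

/-- For l = ±1 the point lies on a row whose end vertices belong to levels k and k + 1, and
`le_row_product` applies. For |l| ≥ 3 the turn condition makes both scaled factors A, B at least 1,
while A + B ≥ 3W − 2; hence AB ≥ A + B − 1 ≥ W. -/
theorem le_product_of_turn (h : E.IsExpansionOf α) (hr : E.IsDigitRep γ t f) {k : ℕ} {Λ : ℝ}
    (hΛ : Λ ≤ 1) (ha : 4 ≤ E.a (k + 1)) (ht : |t (k + 1)| ≤ 1)
    (hx : E.tail (k + 1) ≤ 3 / 11) (hy : E.back k ≤ 3 / 11)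
    (hf : |f (k + 1)| ≤ 1 / 2) (hb : |E.backSum t k| ≤ 1 / 2)
    (hv : ∀ m l : ℝ, (m = 1 ∨ m = -1) → (l = 1 ∨ l = -1) →
      Λ * E.detFactor k ≤ |E.gridX t k m l| * |E.gridY f k m l|)
    (hv' : ∀ m l : ℝ, (m = 1 ∨ m = -1) → (l = 1 ∨ l = -1) →
      Λ * E.detFactor (k + 1) ≤ |E.gridX t (k + 1) m l| * |E.gridY f (k + 1) m l|)
    {m l : ℤ} (hm : Odd m) (hl : Odd l) (hml : |l| < |m|)
    (hl' : |l| ≤ |E.a (k + 1) * l - E.ε (k + 1) * m - t (k + 1)|) :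
    Λ * E.detFactor k ≤ |E.gridX t k m l| * |E.gridY f k m l| := by
  refine le_of_mul_le_mul_right ?_ (tail_denom_pos h k)
  rw [abs_gridX_mul_abs_gridY_mul_fwd h hr, mul_assoc, detFactor_mul_fwd h]
  have ha' : (4 : ℝ) ≤ E.a (k + 1) := by exact_mod_cast ha
  have ht' : |(t (k + 1) : ℝ)| ≤ 1 := by exact_mod_cast ht
  have hx1 := h.tail_pos (k + 1)
  have hy0 := h.back_nonneg k
  have row1 : ∀ m l : ℝ, (m = 1 ∨ m = -1) → (l = 1 ∨ l = -1) →
      Λ * (E.a (k + 1) + E.ε (k + 2) * E.tail (k + 1) + E.ε (k + 1) * E.back k) ≤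
      |E.backSum t k + m + l * E.back k| * |-(t (k + 1) + f (k + 1))
        + l * (E.a (k + 1) + E.ε (k + 2) * E.tail (k + 1)) - m * E.ε (k + 1)| := by
    intro m l hm hl
    have hv1 := mul_le_mul_of_nonneg_right (hv m l hm hl) (tail_denom_pos h k).le
    rwa [abs_gridX_mul_abs_gridY_mul_fwd h hr, mul_assoc, detFactor_mul_fwd h] at hv1
  have row2 : ∀ m l : ℝ, (m = 1 ∨ m = -1) → (l = 1 ∨ l = -1) →
      Λ * (E.a (k + 1) + E.ε (k + 2) * E.tail (k + 1) + E.ε (k + 1) * E.back k) ≤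
      |t (k + 1) - E.ε (k + 1) * E.backSum t k + m * (E.a (k + 1) + E.ε (k + 1) * E.back k) + l|
        * |-f (k + 1) + l - m * E.ε (k + 2) * E.tail (k + 1)| := by
    intro m l hm hl
    have hv1 := mul_le_mul_of_nonneg_right (hv' m l hm hl)
      (zero_le_one.trans (h.back_denom_pos k))
    rwa [abs_gridX_mul_abs_gridY_mul_back h, mul_assoc, detFactor_mul_back h] at hv1
  have hε := h.eps_cases (k + 1)
  have hεr : (E.ε (k + 1) : ℝ) = 1 ∨ (E.ε (k + 1) : ℝ) = -1 := by
    rcases hε with he | he <;> simp [he]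
  have hεr' : (E.ε (k + 2) : ℝ) = 1 ∨ (E.ε (k + 2) : ℝ) = -1 := by
    rcases h.eps_cases (k + 2) with he | he <;> simp [he]
  have hpar := hr.parity k
  clear hv hv'
  generalize (E.ε (k + 2) : ℝ) = e' at *
  generalize E.backSum t k = u at *
  generalize E.back k = y at *
  generalize E.tail (k + 1) = x at *
  generalize f (k + 1) = v at *
  generalize t (k + 1) = s at *
  generalize E.a (k + 1) = a at *
  generalize E.ε (k + 1) = e at *
  have he1 : |(e : ℝ)| = 1 := by rcases hε with rfl | rfl <;> simp
  have heneg : (-(e : ℝ) = 1 ∨ -(e : ℝ) = -1) := by rcases hε with rfl | rfl <;> simp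
  have hee : (e : ℝ) * e = 1 := by rcases hε with rfl | rfl <;> simp
  have hkey : ∀ r : ℝ, |e * r| = |r| := fun r => by rw [abs_mul, he1, one_mul]
  have hem : Odd (e * m) := by rcases hε with rfl | rfl <;> simp [hm]
  have hs1 := abs_le.1 ht
  have hu := abs_le.1 hb
  have hv := abs_le.1 hf
  have hW : 3 ≤ a + e' * x + e * y := by
    rcases hεr with he | he <;> rcases hεr' with he' | he' <;> rw [he, he'] <;> linarith
  have hl3 : l = 1 ∨ l = -1 ∨ 3 ≤ |l| := by
    obtain ⟨i, rfl⟩ := hl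
    rcases abs_cases (2 * i + 1) with h1 | h1 <;> omega
  rcases hl3 with rfl | rfl | hl3
  · have := le_row_product (b := a - s) (M := e * m) (w := e * (u + y)) (z := e' * x - v)
      (κ := Λ * (a + e' * x + e * y)) (by linarith) (by simpa using hpar.neg) hem ?_ ?_ ?_ ?_ ?_ ?_
    · refine this.trans_eq ?_
      congr 1
      · rw [← hkey (u + m + _)]; congr 1; push_cast; ring
      · congr 1; push_cast; ring
    · rw [hkey, abs_le]; constructor <;> linarith
    · rw [abs_le]; rcases hεr' with rfl | rfl <;> constructor <;> linarith
    · convert row1 e 1 hεr (Or.inl rfl) using 2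
      · rw [← hkey (u + e + 1 * y)]; congr 1; linear_combination -hee
      · congr 1; push_cast; linear_combination hee
    · convert row1 (-e) 1 heneg (Or.inl rfl) using 2
      · rw [← hkey (u + -e + 1 * y)]; congr 1; linear_combination hee
      · congr 1; push_cast; linear_combination -hee
    · convert row2 (-1) 1 (Or.inr rfl) (Or.inl rfl) using 2
      · rw [← abs_neg]; congr 1; push_cast; ring
      · congr 1; ring
    · convert row2 (-1) (-1) (Or.inr rfl) (Or.inr rfl) using 2
      · rw [← abs_neg]; congr 1; push_cast; ring
      · congr 1; ring
  · have := le_row_product (b := a + s) (M := -(e * m)) (w := e * (-u + y)) (z := e' * x + v)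
      (κ := Λ * (a + e' * x + e * y)) (by linarith)
      (by rw [show a + s = (s - a) + 2 * a by ring]; exact hpar.add (even_two_mul a))
      hem.neg ?_ ?_ ?_ ?_ ?_ ?_
    · refine this.trans_eq ?_
      congr 1
      · rw [← hkey (u + m + _), abs_eq_abs]; right; push_cast; ring
      · rw [abs_eq_abs]; right; push_cast; ring
    · rw [hkey, abs_le]; constructor <;> linarith
    · rw [abs_le]; rcases hεr' with rfl | rfl <;> constructor <;> linarith
    · convert row1 (-e) (-1) heneg (Or.inr rfl) using 2
      · rw [← hkey (u + -e + -1 * y), abs_eq_abs]; right; linear_combination -hee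
      · rw [abs_eq_abs]; right; push_cast; linear_combination hee
    · convert row1 e (-1) hεr (Or.inr rfl) using 2
      · rw [← hkey (u + e + -1 * y), abs_eq_abs]; right; linear_combination hee
      · rw [abs_eq_abs]; right; push_cast; linear_combination -hee
    · convert row2 1 (-1) (Or.inl rfl) (Or.inr rfl) using 2
      · congr 1; push_cast; ring
      · rw [← abs_neg]; congr 1; ring
    · convert row2 1 1 (Or.inl rfl) (Or.inl rfl) using 2
      · congr 1; push_cast; ring
      · rw [← abs_neg]; congr 1; ring
  · clear row1 row2
    have hl3' : (3 : ℝ) ≤ |(l : ℝ)| := by exact_mod_cast hl3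
    have hml' : |(l : ℝ)| + 1 ≤ |(m : ℝ)| := by exact_mod_cast hml
    have hA : 1 ≤ |u + m + l * y| := by
      have h1 : |(m : ℝ)| ≤ |u + m + l * y| + |u| + |(l : ℝ)| * y := by
        calc |(m : ℝ)| = |(u + m + l * y) - u - l * y| := by congr 1; ring
          _ ≤ |u + m + l * y| + |u| + |l * y| :=
            (abs_sub _ _).trans (by gcongr; exact abs_sub _ _)
          _ = _ := by rw [abs_mul, abs_of_nonneg hy0]
      have h2 := mul_le_mul_of_nonneg_left hy (abs_nonneg (l : ℝ))
      linarith
    have hB : 1 ≤ |-(s + v) + l * (a + e' * x) - m * e| := by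
      have hl'' : |(l : ℝ)| ≤ |(a * l - e * m - s : ℝ)| := by exact_mod_cast hl'
      have he'1 : |e'| = 1 := by rcases hεr' with rfl | rfl <;> simp
      have h1 : |(a * l - e * m - s : ℝ)| ≤ |-(s + v) + l * (a + e' * x) - m * e| + |v|
          + |(l : ℝ)| * x := by
        calc |(a * l - e * m - s : ℝ)|
            = |(-(s + v) + l * (a + e' * x) - m * e) + v - e' * (l * x)| := by congr 1; ring
          _ ≤ |-(s + v) + l * (a + e' * x) - m * e| + |v| + |e' * (l * x)| :=
            (abs_sub _ _).trans (by gcongr; exact abs_add_le _ _)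
          _ = _ := by rw [abs_mul e', he'1, one_mul, abs_mul, abs_of_pos hx1]
      have h2 := mul_le_mul_of_nonneg_left hx (abs_nonneg (l : ℝ))
      linarith
    have hAB : |(l : ℝ)| * (a + e' * x + e * y) ≤ |u + m + l * y| +
        |-(s + v) + l * (a + e' * x) - m * e| + |u| + |(s : ℝ)| + |v| := by
      calc |(l : ℝ)| * (a + e' * x + e * y) = |l * (a + e' * x + e * y)| := by
            rw [abs_mul, abs_of_nonneg (show 0 ≤ a + e' * x + e * y by linarith)]
        _ = |e * (u + m + l * y) + (-(s + v) + l * (a + e' * x) - m * e) - e * u + s + v| := by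
            congr 1; ring
        _ ≤ |e * (u + m + l * y)| + |-(s + v) + l * (a + e' * x) - m * e| + |e * u| + |(s : ℝ)|
            + |v| := by
            refine (abs_add_le _ _).trans ?_
            gcongr
            refine (abs_add_le _ _).trans ?_
            gcongr
            refine (abs_sub _ _).trans ?_
            gcongr
            exact abs_add_le _ _
        _ = _ := by rw [hkey, hkey]
    generalize |u + m + l * y| = A at *
    generalize |-(s + v) + l * (a + e' * x) - m * e| = B at *
    generalize a + e' * x + e * y = W at *
    have h1 : A + B - 1 ≤ A * B := by nlinarith
    have h2 := mul_le_mul_of_nonneg_right hl3' (show 0 ≤ W by linarith)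
    have h3 := mul_le_mul_of_nonneg_right hΛ (show 0 ≤ W by linarith)
    linarith

/-- A sequence of coordinates has a turning point after each level at which it decreases. -/
theorem exists_turn {m l : ℕ → ℤ} (hm : ∀ k, m (k + 1) = -l k) {K : ℕ} (hK : |l K| < |m K|) :
    ∃ k ≥ K, |l k| < |m k| ∧ |l k| ≤ |l (k + 1)| := by
  -- Since m_{k+1} = −l_k, the condition |l| < |m| passes to the next level as long as |l| drops, so
  -- without a turn |l| would decrease for ever.
  by_contra! hcon
  have hdec : ∀ j : ℕ, |l (K + j)| < |m (K + j)| ∧ |l (K + j)| + j ≤ |l K| := by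
    intro j
    induction j with
    | zero => simpa using hK
    | succ j ih =>
      have h1 := hcon (K + j) (by omega) ih.1
      have h2 := hm (K + j)
      rw [← add_assoc]
      refine ⟨by rwa [h2, abs_neg], ?_⟩
      push_cast
      linarith [ih.2]
  have h1 := (hdec (|l K| + 1).toNat).2
  rw [Int.toNat_of_nonneg (by positivity)] at h1
  linarith [abs_nonneg (l (K + (|l K| + 1).toNat))]

/-- A lower bound for all vertices of large level is a lower bound for `M α γ`. -/
theorem IsDigitRep.le_M (h : E.IsExpansionOf α) (hr : E.IsDigitRep γ t f) {Λ : ℝ} (hΛ : Λ ≤ 1)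
    (ha : ∀ᶠ i in atTop, 4 ≤ E.a i) (ht : ∀ k, |t (k + 1)| ≤ 1)
    (hf : ∀ᶠ k in atTop, |f k| ≤ 1 / 2) (hb : ∀ᶠ k in atTop, |E.backSum t k| ≤ 1 / 2)
    (hv : ∀ᶠ k in atTop, ∀ m l : ℝ, (m = 1 ∨ m = -1) → (l = 1 ∨ l = -1) →
      Λ * E.detFactor k ≤ |E.gridX t k m l| * |E.gridY f k m l|) :
    ((Λ / 4 : ℝ) : EReal) ≤ M α γ := by
  obtain ⟨K, hK⟩ := eventually_atTop.1 ((((ha.and hf).and hb).and hv).and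
    (h.eventually_le_three_div_eleven ha))
  set C := (E.tailProd K)⁻¹ + 1 / 2 with hC
  have hCpos : 0 < C := by have := h.tailProd_pos K; positivity
  refine le_liminf_of_le (by isBoundedDefault) ?_
  rw [eventually_cofinite]
  refine Set.Finite.subset (Set.finite_Icc (-⌈E.den K * (2 * C + 1)⌉) ⌈E.den K * (2 * C + 1)⌉) ?_
  intro n hn
  by_contra hbig
  refine hn ?_
  rw [EReal.coe_le_coe_iff]
  have hbig' : E.den K * (2 * C + 1) < |(n : ℝ)| := by
    by_contra! hle
    refine hbig ?_
    rw [Set.mem_Icc, ← abs_le]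
    have : |(n : ℝ)| ≤ ⌈E.den K * (2 * C + 1)⌉ := hle.trans (Int.le_ceil _)
    exact_mod_cast this
  obtain ⟨m, l, hodd, hm, hl, hpt⟩ := hr.exists_coord h n (round (n * α - γ))
  have hdist : distInt (n * α - γ) = |n * α - round (n * α - γ) - γ| := by
    rw [distInt, sub_right_comm]
  -- At the fixed level K the bound |nα − P − γ| ≤ 1/2 bounds Y. If |m| ≤ |l|, this bounds l, hence
  -- m and n, against the choice of n.
  have hlm : |l K| < |m K| := by
    obtain ⟨h1, h2⟩ := hpt K
    obtain ⟨⟨⟨⟨-, hf1⟩, hb1⟩, -⟩, hx1, hy1⟩ := hK K le_rfl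
    by_contra! hle
    have hle' : |(m K : ℝ)| ≤ |(l K : ℝ)| := by exact_mod_cast hle
    have hhalf : |n * α - round (n * α - γ) - γ| ≤ 1 / 2 := by
      rw [← hdist]; exact abs_sub_round _
    have htp := h.tailProd_pos K
    have hdp := h.den_pos K
    have hY : |-f K + l K - m K * E.ε (K + 1) * E.tail K| ≤ (E.tailProd K)⁻¹ := by
      have := congrArg abs h2
      rw [abs_mul, abs_mul, abs_of_pos htp, abs_two] at this
      rw [← one_div, le_div_iff₀ htp]
      linarith
    have hε : |(E.ε (K + 1) : ℝ)| = 1 := by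
      rcases h.eps_cases (K + 1) with he | he <;> simp [he]
    have hl1 : |(l K : ℝ)| ≤ C + |(m K : ℝ)| * (3 / 11) := by
      calc |(l K : ℝ)| = |(-f K + l K - m K * E.ε (K + 1) * E.tail K) + f K
            + m K * E.ε (K + 1) * E.tail K| := by congr 1; ring
        _ ≤ |-f K + l K - m K * E.ε (K + 1) * E.tail K| + |f K|
            + |m K * E.ε (K + 1) * E.tail K| :=
            (abs_add_le _ _).trans (by gcongr; exact abs_add_le _ _)
        _ ≤ (E.tailProd K)⁻¹ + 1 / 2 + |(m K : ℝ)| * (3 / 11) := by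
            rw [abs_mul, abs_mul, hε, mul_one, abs_of_pos (h.tail_pos K)]
            gcongr
    have hX : |E.backSum t K + m K + l K * E.back K| ≤
        1 / 2 + |(m K : ℝ)| + |(l K : ℝ)| * (3 / 11) := by
      refine (abs_add_le _ _).trans (add_le_add ((abs_add_le _ _).trans ?_) ?_)
      · gcongr
      · rw [abs_mul, abs_of_nonneg (h.back_nonneg K)]
        gcongr
    have hn2 : 2 * |(n : ℝ)| = E.den K * |E.backSum t K + m K + l K * E.back K| := by
      have hs : |(E.sgn K : ℝ)| = 1 := by
        have := h.sgn_sq K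
        rw [← abs_mul_abs_self] at this
        nlinarith [abs_nonneg (E.sgn K : ℝ)]
      have := congrArg abs h1
      rwa [abs_mul, hs, abs_mul, abs_mul, abs_of_pos hdp, one_mul, abs_two] at this
    have h5 := mul_le_mul_of_nonneg_left (hX.trans (show _ ≤ 2 * (2 * C + 1) by linarith)) hdp.le
    linarith
  obtain ⟨k, hk, hk1, hk2⟩ := exists_turn hm hlm
  obtain ⟨⟨⟨-, hb1⟩, hv1⟩, -, hy1⟩ := hK k hk
  obtain ⟨⟨⟨⟨ha2, hf2⟩, -⟩, hv2⟩, hx2, -⟩ := hK (k + 1) (by omega)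
  rw [hl k] at hk2
  have h1 := le_product_of_turn h hr hΛ ha2 (ht k) hx2 hy1 hf2 hb1 hv1 hv2 (hodd k).1 (hodd k).2
    hk1 hk2
  have h2 := h.abs_mul_abs_eq (hpt k).1 (hpt k).2
  rw [← hdist] at h2
  rw [gridX, gridY, ← h2] at h1
  have h3 := le_of_mul_le_mul_right h1 (h.detFactor_pos k)
  linarith


/-! ### The digits of γ_* and the sign of their forward sums -/

variable {E : Expansion} {α γ : ℝ}

theorem q_mul_sub_p (h : E.IsExpansionOf α) (k : ℕ) :
    (E.q k : ℝ) * α - E.p k = E.sgn (k + 1) * E.tailProd (k + 1) := by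
  induction k using Nat.strong_induction_on with
  | _ k ih =>
    match k with
    | 0 => simp [q, p, sgn, tailProd, h.a_zero, h.eps_one, h.tail_zero]
    | 1 =>
      have ht := h.tail_mul 0
      simp only [q, p, sgn, tailProd, h.a_zero, h.eps_one, zero_add, h.tail_zero] at ht ⊢
      push_cast
      linear_combination ht
    | k + 2 =>
      have h1 := ih (k + 1) (by omega)
      have h0 := ih k (by omega)
      have ht := h.tail_mul (k + 1)
      rw [q, p]
      simp only [sgn, tailProd] at h1 h0 ⊢
      push_cast at h1 h0 ⊢
      have he := h.eps_sq (k + 2)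
      linear_combination E.a (k + 2) * h1 + E.ε (k + 2) * h0 +
        E.ε (k + 2) * E.ε (k + 1) * E.sgn k * E.tailProd k * E.tail k * ht

theorem D_eq_tailProd (h : E.IsExpansionOf α) (k : ℕ) : E.D α k = E.tailProd (k + 1) := by
  rw [D, q_mul_sub_p h, abs_mul, abs_of_pos (h.tailProd_pos _)]
  have hs : |(E.sgn (k + 1) : ℝ)| = 1 := by
    have := h.sgn_sq (k + 1)
    rw [← abs_mul_abs_self] at this
    nlinarith [abs_nonneg (E.sgn (k + 1) : ℝ)]
  rw [hs, one_mul]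

theorem tailProd_add_le (h : E.IsExpansionOf α) {K : ℕ} (hK : ∀ k ≥ K, E.tail k ≤ 1 / 2) {k : ℕ}
    (hk : K ≤ k) (j : ℕ) : E.tailProd (k + j) ≤ E.tailProd k * (1 / 2) ^ j := by
  induction j with
  | zero => simp
  | succ j ih =>
    rw [← add_assoc, tailProd, pow_succ, ← mul_assoc]
    exact mul_le_mul ih (hK _ (by omega)) (h.tail_pos _).le
      (mul_nonneg (h.tailProd_pos _).le (by positivity))

theorem summable_tailProd (h : E.IsExpansionOf α) (hx : ∀ᶠ k in atTop, E.tail k ≤ 1 / 2) :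
    Summable E.tailProd := by
  obtain ⟨K, hK⟩ := eventually_atTop.1 hx
  rw [← summable_nat_add_iff K]
  refine Summable.of_nonneg_of_le (fun j => (h.tailProd_pos _).le)
    (fun j => ?_) ((summable_geometric_two).mul_left (E.tailProd K))
  rw [add_comm]
  exact tailProd_add_le h hK le_rfl j

theorem abs_lam_le_one (E : Expansion) (i : ℕ) : |(E.lam i : ℝ)| ≤ 1 := by
  unfold lam
  split_ifs
  · simp
  · simp

/-- The normalised forward sums of the digits of `γ_*`. -/
def starFwd (E : Expansion) (k : ℕ) : ℝ :=
  (∑' i : ℕ, E.lam (k + 1 + i) * E.tailProd (k + 1 + i)) / E.tailProd k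

section

variable (h : E.IsExpansionOf α) (hx : ∀ᶠ k in atTop, E.tail k ≤ 1 / 2)
include h hx

theorem summable_lam_mul (k : ℕ) :
    Summable fun i => (E.lam (k + i) : ℝ) * E.tailProd (k + i) := by
  have h1 : Summable fun i => E.tailProd (k + i) := by
    simpa only [add_comm] using (summable_nat_add_iff k).2 (summable_tailProd h hx)
  refine Summable.of_norm_bounded h1 fun i => ?_
  rw [norm_mul, Real.norm_eq_abs, Real.norm_eq_abs, abs_of_pos (h.tailProd_pos _)]
  exact mul_le_of_le_one_left (h.tailProd_pos _).le (abs_lam_le_one _ _)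

theorem starFwd_eq (k : ℕ) : E.starFwd k = E.tail k * (E.lam (k + 1) + E.starFwd (k + 1)) := by
  have h1 := (summable_lam_mul h hx (k + 1)).tsum_eq_zero_add
  have h2 := (h.tailProd_pos k).ne'
  have h3 := (h.tail_pos k).ne'
  have h4 : ∀ i, (E.lam (k + 1 + (i + 1)) : ℝ) * E.tailProd (k + 1 + (i + 1)) =
      E.lam (k + 1 + 1 + i) * E.tailProd (k + 1 + 1 + i) := fun i => by
    rw [show k + 1 + (i + 1) = k + 1 + 1 + i by ring]
  have h5 : E.tailProd (k + 1) = E.tailProd k * E.tail k := rfl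
  rw [starFwd, starFwd, h1, tsum_congr h4, add_zero, h5]
  field_simp

/-- The part without λ telescopes: (a_{i+1} − 1 + ε_{i+1}) D_i = G_i − G_{i+1} with G_i = D_{i−1} +
ε_{i+1} D_i, which leaves G_0 = 1 + α. -/
theorem isDigitRep_gammaStar : E.IsDigitRep (E.gammaStar α) E.lam E.starFwd := by
  refine ⟨fun k => ?_, starFwd_eq h hx, 0, ?_⟩
  · rcases Int.even_or_odd (E.a (k + 1)) with hp | hp
    · rw [lam, if_neg (Int.not_odd_iff_even.2 hp), zero_sub]
      exact hp.neg
    · rw [lam, if_pos hp]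
      exact (Odd.pow (by decide)).sub_odd hp
  · set G : ℕ → ℝ := fun i => E.tailProd i + E.ε (i + 1) * E.tailProd (i + 1) with hG
    have hsum := summable_tailProd h hx
    have hG1 : Summable G := by
      refine hsum.add (Summable.of_norm_bounded ((summable_nat_add_iff 1).2 hsum) fun i => ?_)
      rw [norm_mul, Real.norm_eq_abs, Real.norm_eq_abs, abs_of_pos (h.tailProd_pos _)]
      rcases h.eps_cases (i + 1) with he | he <;> simp [he]
    have hG2 := hG1.tsum_eq_zero_add
    have hlam : Summable fun i => (E.lam (i + 1) : ℝ) * E.tailProd (i + 1) := by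
      simpa only [add_comm] using summable_lam_mul h hx 1
    have hterm : ∀ i, (1 / 2 : ℝ) * ((E.a (i + 1) - 1 + E.ε (i + 1) + E.lam (i + 1) : ℤ) : ℝ) *
        E.D α i = (1 / 2) * ((G i - G (i + 1)) + E.lam (i + 1) * E.tailProd (i + 1)) := by
      intro i
      rw [D_eq_tailProd h]
      have ht := h.tail_mul i
      simp only [hG, tailProd]
      push_cast
      linear_combination (1 / 2) * E.tailProd i * ht
    have h0 : E.starFwd 0 = ∑' i, (E.lam (i + 1) : ℝ) * E.tailProd (i + 1) := by
      have h1 : E.tailProd 0 = 1 := rfl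
      rw [starFwd, h1, div_one]
      exact tsum_congr fun i => by rw [zero_add, add_comm 1 i]
    have hG1' : Summable fun i => G (i + 1) := (summable_nat_add_iff 1).2 hG1
    rw [gammaStar, tsum_congr hterm, tsum_mul_left, (hG1.sub hG1').tsum_add hlam,
      hG1.tsum_sub hG1', ← h0, hG2]
    have : G 0 = 1 + E.tail 0 := by simp [hG, tailProd, h.eps_one]
    rw [this]
    push_cast
    ring

end

/-- The sign of the next nonzero `λ_i`, `i > k`. -/
def nextSign (E : Expansion) (k : ℕ) : ℤ :=
  -(-1) ^ ((Finset.Icc 1 k).filter fun j => Odd (E.a j)).card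

theorem nextSign_cases (E : Expansion) (k : ℕ) : E.nextSign k = 1 ∨ E.nextSign k = -1 := by
  unfold nextSign
  rcases neg_one_pow_eq_or ℤ ((Finset.Icc 1 k).filter fun j => Odd (E.a j)).card with h | h <;>
    simp [h]

theorem lam_of_even {k : ℕ} (hk : Even (E.a k)) : E.lam k = 0 := by
  rw [lam, if_neg (Int.not_odd_iff_even.2 hk)]

theorem lam_of_odd {k : ℕ} (hk : Odd (E.a k)) : E.lam k = -E.nextSign k := by
  rw [lam, if_pos hk, nextSign, neg_neg]

theorem nextSign_succ_of_even {k : ℕ} (hk : Even (E.a (k + 1))) :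
    E.nextSign (k + 1) = E.nextSign k := by
  rw [nextSign, nextSign, ← Finset.insert_Icc_right_eq_Icc_add_one (by omega),
    Finset.filter_insert, if_neg (Int.not_odd_iff_even.2 hk)]

theorem nextSign_succ_of_odd {k : ℕ} (hk : Odd (E.a (k + 1))) :
    E.nextSign (k + 1) = -E.nextSign k := by
  rw [nextSign, nextSign, ← Finset.insert_Icc_right_eq_Icc_add_one (by omega),
    Finset.filter_insert, if_pos hk, Finset.card_insert_of_notMem (by simp), pow_succ]
  ring

/-- The forward sums of `γ_*` have the sign of the next nonzero digit. -/
theorem eventually_nextSign_mul_starFwd_mem (h : E.IsExpansionOf α)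
    (hx : ∀ᶠ k in atTop, E.tail k ≤ 1 / 2) :
    ∀ᶠ k in atTop, 0 ≤ E.nextSign k * E.starFwd k ∧ E.nextSign k * E.starFwd k ≤ E.tail k := by
  obtain ⟨K, hK⟩ := eventually_atTop.1 hx
  -- Put g = `nextSign` · `starFwd`. An odd quotient gives g_k = α_k (1 − g_{k+1}), an even one g_k
  -- = α_k g_{k+1}. Both maps send [0, 1] into [0, α_k] and, as α_k ≤ 1/2, halve any overshoot
  -- outside [0, 1]; iterating from |g| ≤ 1 removes the overshoot.
  have hstep : ∀ k, E.nextSign k * E.starFwd k =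
        E.tail k * (1 - E.nextSign (k + 1) * E.starFwd (k + 1)) ∨
      E.nextSign k * E.starFwd k = E.tail k * (E.nextSign (k + 1) * E.starFwd (k + 1)) := by
    intro k
    rw [starFwd_eq h hx]
    rcases Int.even_or_odd (E.a (k + 1)) with hp | hp
    · right
      rw [lam_of_even hp, nextSign_succ_of_even hp]
      push_cast
      ring
    · left
      rw [lam_of_odd hp, nextSign_succ_of_odd hp]
      have : (E.nextSign k : ℝ) * E.nextSign k = 1 := by
        rcases E.nextSign_cases k with hs | hs <;> simp [hs]
      push_cast
      linear_combination E.tail k * this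
  have habs : ∀ k, |(E.nextSign k : ℝ)| = 1 := by
    intro k
    rcases E.nextSign_cases k with hs | hs <;> simp [hs]
  have hbound : ∀ k ≥ K, |E.starFwd k| ≤ 1 := by
    intro k hk
    have hp := h.tailProd_pos k
    rw [starFwd, abs_div, abs_of_pos hp, div_le_one hp]
    have hs : HasSum (fun i : ℕ => E.tailProd k * (1 / 2) * (1 / 2) ^ i)
        (E.tailProd k * (1 / 2) * 2) := hasSum_geometric_two.mul_left _
    have := tsum_of_norm_bounded (f := fun i => (E.lam (k + 1 + i) : ℝ) * E.tailProd (k + 1 + i))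
      hs fun i => by
        rw [norm_mul, Real.norm_eq_abs, Real.norm_eq_abs, abs_of_pos (h.tailProd_pos _)]
        refine (mul_le_of_le_one_left (h.tailProd_pos _).le (abs_lam_le_one _ _)).trans ?_
        have := tailProd_add_le h hK hk (1 + i)
        rw [pow_add, pow_one, ← mul_assoc, ← add_assoc] at this
        exact this
    rw [Real.norm_eq_abs] at this
    linarith
  have happrox : ∀ j : ℕ, ∀ k ≥ K, -(1 / 2 : ℝ) ^ j ≤ E.nextSign k * E.starFwd k ∧
      E.nextSign k * E.starFwd k ≤ 1 + (1 / 2) ^ j := by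
    intro j
    induction j with
    | zero =>
      intro k hk
      have h1 : |E.nextSign k * E.starFwd k| ≤ 1 := by
        rw [abs_mul, habs, one_mul]
        exact hbound k hk
      rw [abs_le] at h1
      rw [pow_zero]
      constructor <;> linarith [h1.1, h1.2]
    | succ j ih =>
      intro k hk
      have h1 := ih (k + 1) (by omega)
      have h2 := hK k hk
      have h3 := h.tail_pos k
      have h4 : (0 : ℝ) < (1 / 2) ^ j := by positivity
      rw [pow_succ]
      rcases hstep k with hs | hs <;> rw [hs] <;> constructor <;> nlinarith
  have hlim : Tendsto (fun j : ℕ => (1 / 2 : ℝ) ^ j) atTop (nhds 0) :=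
    tendsto_pow_atTop_nhds_zero_of_lt_one (by norm_num) (by norm_num)
  have hmem : ∀ k ≥ K, 0 ≤ E.nextSign k * E.starFwd k ∧ E.nextSign k * E.starFwd k ≤ 1 := by
    intro k hk
    constructor
    · have h1 := hlim.neg
      rw [neg_zero] at h1
      exact le_of_tendsto' h1 fun j => (happrox j k hk).1
    · have h1 := hlim.const_add 1
      rw [add_zero] at h1
      exact ge_of_tendsto' h1 fun j => (happrox j k hk).2
  refine eventually_atTop.2 ⟨K, fun k hk => ⟨(hmem k hk).1, ?_⟩⟩
  have h1 := hmem (k + 1) (by omega)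
  have h3 := h.tail_pos k
  rcases hstep k with hs | hs <;> rw [hs] <;> nlinarith

end Expansion

/-! ### Vertex inequalities according to sign and parity -/

/-- The four vertices of a level are bounded below by `Λ`. Here `e`, `x`, `y` are the sign, the
forward tail and the backward tail, and `b`, `f` the backward and forward sums. -/
structure VertexGe (e x y b f Λ : ℝ) : Prop where
  pp : Λ * (1 + e * x * y) ≤ (1 + y + b) * (1 - e * x - f)
  mp : Λ * (1 + e * x * y) ≤ (1 - y - b) * (1 + e * x - f)
  pm : Λ * (1 + e * x * y) ≤ (1 - y + b) * (1 + e * x + f)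
  mm : Λ * (1 + e * x * y) ≤ (1 + y - b) * (1 - e * x + f)

/-- Negating b and f swaps the vertex (m, l) with (−m, −l), so the digit at an odd quotient may be
taken to be 1. -/
theorem VertexGe.of_sign {e x y b f Λ τ : ℝ} (hτ : τ = 1 ∨ τ = -1)
    (h : VertexGe e x y (τ * b) (τ * f) Λ) : VertexGe e x y b f Λ := by
  rcases hτ with rfl | rfl
  · simpa using h
  · obtain ⟨h1, h2, h3, h4⟩ := h
    exact ⟨by linarith, by linarith, by linarith, by linarith⟩

/-- After an odd quotient b lies near y and f ≤ 0. Here `h1` serves the vertex (1, 1), `h2` serves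
(−1, 1), and `h3` serves the two with l = −1, where f reduces |Y|. -/
theorem vertexGe_odd_of_pos {x y b f g Λ B : ℝ} (hx : 0 ≤ x) (hy : 0 ≤ y) (hB0 : 0 ≤ B)
    (hB1 : B ≤ 1) (hΛ : 0 ≤ Λ)
    (hb0 : y * (1 - B) ≤ b) (hb1 : b ≤ y * (1 + B)) (hf0 : -g ≤ f) (hf1 : f ≤ 0)
    (h1 : Λ ≤ 1 - x - g) (h2 : Λ ≤ 1 - y * (2 + B))
    (h3 : Λ * (1 + x * y) ≤ (1 - y * B) * (1 - x - g)) : VertexGe 1 x y b f Λ := by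
  have hyB : 0 ≤ y * B := mul_nonneg hy hB0
  have hxy : 0 ≤ x * y := mul_nonneg hx hy
  have hby : 0 ≤ b := le_trans (mul_nonneg hy (by linarith)) hb0
  constructor
  · have e1 : (1 + y) * (1 - x) ≤ (1 + y + b) * (1 - 1 * x - f) :=
      mul_le_mul (by linarith) (by linarith) (by linarith) (by linarith)
    have e2 : Λ * (1 + x * y) ≤ (1 - x) * (1 + y) :=
      mul_le_mul (by linarith) (by nlinarith) (by linarith) (by linarith)
    linarith
  · have e2 : Λ * (1 + x * y) ≤ (1 - y - b) * (1 + 1 * x - f) :=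
      mul_le_mul (by linarith) (by nlinarith) (by linarith) (by linarith)
    linarith
  · have e1 : (1 - y * B) * (1 - x - g) ≤ (1 - y + b) * (1 + 1 * x + f) :=
      mul_le_mul (by linarith) (by linarith) (by linarith) (by linarith)
    linarith
  · have e1 : (1 - y * B) * (1 - x - g) ≤ (1 + y - b) * (1 - 1 * x + f) :=
      mul_le_mul (by linarith) (by linarith) (by linarith) (by linarith)
    linarith

theorem vertexGe_even_of_pos {x y b f g Λ B : ℝ} (hx : 0 ≤ x) (hy : 0 ≤ y)
    (hΛ : 0 ≤ Λ) (hb : |b| ≤ y * B) (hf : |f| ≤ g) (hg : g ≤ x) (hxB : x + B ≤ 1)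
    (h1 : Λ ≤ 1 - x - g) (h2 : Λ * (1 + x * y) ≤ 1 - y * (1 + B)) : VertexGe 1 x y b f Λ := by
  rw [abs_le] at hb hf
  have hxy : 0 ≤ x * y := mul_nonneg hx hy
  have e0 : 1 + x * y ≤ 1 + y - y * B := by nlinarith
  have hpos : 0 ≤ Λ * (1 + x * y) := mul_nonneg hΛ (by linarith)
  constructor
  · have : Λ * (1 + x * y) ≤ (1 - 1 * x - f) * (1 + y + b) :=
      mul_le_mul (by linarith) (by linarith) (by linarith) (by linarith)
    linarith
  · nlinarith [mul_nonneg (show 0 ≤ 1 - y - b by linarith) (show 0 ≤ x - f by linarith)]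
  · nlinarith [mul_nonneg (show 0 ≤ 1 - y + b by linarith) (show 0 ≤ x + f by linarith)]
  · have : Λ * (1 + x * y) ≤ (1 - 1 * x + f) * (1 + y - b) :=
      mul_le_mul (by linarith) (by linarith) (by linarith) (by linarith)
    linarith

/-- With ε = −1 the vertex (−1, 1) is critical: its factors are about 1 − 2y and 1 − x. It is left
as the hypothesis `h2`, for a finer estimate when the next quotient is even. -/
theorem vertexGe_odd_of_neg {x y b f g Λ B : ℝ} (hx : 0 ≤ x) (hy : 0 ≤ y) (hB0 : 0 ≤ B)
    (hB1 : B ≤ 1) (hΛ : 0 ≤ Λ) (hΛ1 : Λ ≤ 1)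
    (hb0 : y * (1 - B) ≤ b) (hb1 : b ≤ y * (1 + B)) (hf0 : -g ≤ f) (hf1 : f ≤ 0)
    (hyB1 : y * B ≤ 1) (hxg : x + g ≤ 1)
    (h2 : Λ * (1 - x * y) ≤ (1 - y - b) * (1 - x - f))
    (h3 : Λ ≤ (1 - y * B) * (1 - x - g)) : VertexGe (-1) x y b f Λ := by
  have hyB : 0 ≤ y * B := mul_nonneg hy hB0
  have hxy : 0 ≤ x * y := mul_nonneg hx hy
  have hby : 0 ≤ b := le_trans (mul_nonneg hy (by linarith)) hb0
  have e0 : Λ * (1 + -1 * x * y) ≤ Λ := by nlinarith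
  constructor
  · nlinarith [mul_nonneg (show 0 ≤ y + b by linarith) (show 0 ≤ x - f by linarith)]
  · linarith
  · have e1 : (1 - y * B) * (1 - x - g) ≤ (1 - y + b) * (1 + -1 * x + f) :=
      mul_le_mul (by linarith) (by linarith) (by linarith) (by linarith)
    linarith
  · have e1 : (1 - y * B) * (1 - x - g) ≤ (1 + y - b) * (1 - -1 * x + f) :=
      mul_le_mul (by linarith) (by linarith) (by linarith) (by linarith)
    linarith

theorem vertexGe_even_of_neg {x y b f g Λ B : ℝ} (hx : 0 ≤ x) (hy : 0 ≤ y)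
    (hB1 : B ≤ 1) (hΛ : 0 ≤ Λ) (hΛ1 : Λ ≤ 1) (hb : |b| ≤ y * B) (hf : |f| ≤ g) (hg : g ≤ x)
    (hyB : y * (1 + B) ≤ 1) (hxg : x + g ≤ 1)
    (h : Λ * (1 - x * y) ≤ (1 - y * (1 + B)) * (1 - x - g)) : VertexGe (-1) x y b f Λ := by
  rw [abs_le] at hb hf
  have hxy : 0 ≤ x * y := mul_nonneg hx hy
  have hyB' : y * B ≤ y := mul_le_of_le_one_right hy hB1
  have e0 : Λ * (1 + -1 * x * y) ≤ 1 := by nlinarith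
  constructor
  · nlinarith [mul_nonneg (show 0 ≤ y + b by linarith) (show 0 ≤ x - f by linarith)]
  · have e1 : (1 - y * (1 + B)) * (1 - x - g) ≤ (1 - y - b) * (1 + -1 * x - f) :=
      mul_le_mul (by linarith) (by linarith) (by linarith) (by linarith)
    linarith
  · have e1 : (1 - y * (1 + B)) * (1 - x - g) ≤ (1 - y + b) * (1 + -1 * x + f) :=
      mul_le_mul (by linarith) (by linarith) (by linarith) (by linarith)
    linarith
  · nlinarith [mul_nonneg (show 0 ≤ y - b by linarith) (show 0 ≤ x + f by linarith)]

/-- The critical vertex when the backward denominator is `D = 1 / y`. -/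
theorem critical_vertex {x y D r Λ : ℝ} (hD : y * D = 1) (hy : 0 ≤ y)
    (h : Λ * (D - x) ≤ (D - 2 - r) * (1 - x)) :
    Λ * (1 - x * y) ≤ (1 - y * (2 + r)) * (1 - x) := by
  have := mul_le_mul_of_nonneg_left h hy
  linear_combination this - (Λ - (1 - x)) * hD

/-- Moving D, r, β and x in turn to their extreme values costs the nonnegative terms `e1` to `e4`;
what remains is `h`. Keeping β in both D and r retains their correlation. -/
theorem critical_of_pos {x D r Λ N β θ θ' B : ℝ} (hx : x ≤ θ')
    (hβ : β ≤ θ) (hB : 0 ≤ B) (hΛ0 : 0 ≤ Λ) (hΛ : Λ ≤ 1 - θ') (hΛN : Λ ≤ N - 2 - θ * B)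
    (hD : N + β ≤ D) (hr : r ≤ β * (1 + B))
    (h : Λ * (N + θ - θ') ≤ (N - 2 - θ * B) * (1 - θ')) :
    Λ * (D - x) ≤ (D - 2 - r) * (1 - x) := by
  have e1 : 0 ≤ (D - N - β) * (1 - x - Λ) := mul_nonneg (by linarith) (by linarith)
  have e2 : 0 ≤ (β * (1 + B) - r) * (1 - x) := mul_nonneg (by linarith) (by linarith)
  have e3 : 0 ≤ (θ - β) * (B * (1 - x) + Λ) :=
    mul_nonneg (by linarith) (add_nonneg (mul_nonneg hB (by linarith)) hΛ0)
  have e4 : 0 ≤ (θ' - x) * (N - 2 - θ * B - Λ) := mul_nonneg (by linarith) (by linarith)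
  linarith

theorem critical_of_neg {x D r Λ N β θ θ' B : ℝ} (hx : x ≤ θ')
    (hβ : β ≤ θ) (hB : 0 ≤ B) (hΛ : Λ ≤ 1 - θ') (hΛN : Λ ≤ N - 2 - θ - θ * B)
    (hθ' : θ' ≤ 1) (hD : N - β ≤ D) (hr : r ≤ β * B)
    (h : Λ * (N - θ - θ') ≤ (N - 2 - θ - θ * B) * (1 - θ')) :
    Λ * (D - x) ≤ (D - 2 - r) * (1 - x) := by
  have e1 : 0 ≤ (D - N + β) * (1 - x - Λ) := mul_nonneg (by linarith) (by linarith)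
  have e2 : 0 ≤ (β * B - r) * (1 - x) := mul_nonneg (by linarith) (by linarith)
  have e3 : 0 ≤ (θ - β) * ((1 - x - Λ) + B * (1 - x)) :=
    mul_nonneg (by linarith) (add_nonneg (by linarith) (mul_nonneg hB (by linarith)))
  have e4 : 0 ≤ (θ' - x) * (N - 2 - θ - θ * B - Λ) := mul_nonneg (by linarith) (by linarith)
  linarith

/-- Numerical conditions for `Λ` to bound the vertices of `γ_*` when `ε_{k+1} = 1`; here `θo` and
`θe` bound the tails next to odd and even partial quotients. -/
structure PosBounds (Λ θo θe B : ℝ) : Prop where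
  Λ_nonneg : 0 ≤ Λ
  θo_nonneg : 0 ≤ θo
  θe_nonneg : 0 ≤ θe
  θo_le : θo ≤ B
  θe_le : θe ≤ B
  B_le : B ≤ 1 / 3
  contract : θo * (1 + B) < B
  odd_odd : Λ * (1 + θo * θo) ≤ (1 - θo * B) * (1 - 2 * θo)
  odd_even : Λ * (1 + θo * θe) ≤ (1 - θo * B) * (1 - θe * (1 + B))
  odd_large : Λ ≤ 1 - θo * (2 + B)
  even_odd : Λ * (1 + θe * θo) ≤ 1 - θe * (1 + B)
  even_even : Λ * (1 + θe * θe) ≤ 1 - θe * (1 + B)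

/-- Additional numerical conditions for the case `ε_{k+1} = -1`. -/
structure NegBounds (N Λ θo θe θ B : ℝ) : Prop where
  θo_le : θo ≤ θ
  θe_le : θe ≤ θ
  θ_le : θ ≤ 1 / 3
  le_N : 4 ≤ N
  odd_odd : Λ ≤ (1 - θo * (2 + B)) * (1 - θo * B)
  odd_even_pos : Λ * (N + θ - θe) ≤ (N - 2 - θ * B) * (1 - θe)
  odd_even_neg : Λ * (N - θ - θe) ≤ (N - 2 - θ - θ * B) * (1 - θe)
  even_odd : Λ * (1 - θo * θe) ≤ (1 - θe * (1 + B)) * (1 - 2 * θo)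
  even_even : Λ ≤ (1 - θe * (1 + B)) * (1 - θe * (1 + B))

namespace PosBounds

variable {Λ θo θe B : ℝ} (H : PosBounds Λ θo θe B)
include H

theorem B_nonneg : 0 ≤ B := H.θo_nonneg.trans H.θo_le

theorem odd_le : θo ≤ 1 / 3 := H.θo_le.trans H.B_le

theorem even_le : θe ≤ 1 / 3 := H.θe_le.trans H.B_le

theorem odd_mul_le : θo * B ≤ 1 / 9 :=
  (mul_le_mul H.odd_le H.B_le H.B_nonneg (by norm_num)).trans_eq (by norm_num)

theorem even_mul_le : θe * B ≤ 1 / 9 :=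
  (mul_le_mul H.even_le H.B_le H.B_nonneg (by norm_num)).trans_eq (by norm_num)

theorem le_prod_odd : Λ ≤ (1 - θo * B) * (1 - 2 * θo) := by
  have h1 := H.odd_odd
  have h2 := mul_nonneg H.Λ_nonneg (mul_nonneg H.θo_nonneg H.θo_nonneg)
  linarith

theorem le_prod_even : Λ ≤ (1 - θo * B) * (1 - θe * (1 + B)) := by
  have h1 := H.odd_even
  have h2 := mul_nonneg H.Λ_nonneg (mul_nonneg H.θo_nonneg H.θe_nonneg)
  linarith

theorem le_odd : Λ ≤ 1 - 2 * θo := by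
  have h1 := H.le_prod_odd
  have h2 := mul_nonneg (mul_nonneg H.θo_nonneg H.B_nonneg)
    (show 0 ≤ 1 - 2 * θo by linarith [H.odd_le])
  linarith

theorem le_even : Λ ≤ 1 - θe * (1 + B) := by
  have h1 := H.even_even
  have h2 := mul_nonneg H.Λ_nonneg (mul_nonneg H.θe_nonneg H.θe_nonneg)
  linarith

theorem le_one : Λ ≤ 1 := by linarith [H.le_odd, H.θo_nonneg]

variable {N θ e x y b f : ℝ}

theorem vertexGe_even_odd (hx : 0 ≤ x) (hy : 0 ≤ y) (hyθ : y ≤ θe) (hxθ : x ≤ θo)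
    (hb : |b| ≤ y * B) (hf : |f| ≤ x) (he : e = 1 ∨ (e = -1 ∧ NegBounds N Λ θo θe θ B)) :
    VertexGe e x y b f Λ := by
  have hB := H.B_nonneg
  have hB1 := H.B_le
  have hyB : y * (1 + B) ≤ θe * (1 + B) := mul_le_mul_of_nonneg_right hyθ (by linarith)
  have hΛ := H.Λ_nonneg
  have hΛ1 := H.le_one
  have ho := H.odd_le
  have hee := H.even_le
  have hem := H.even_mul_le
  have hxy : x * y ≤ θo * θe := mul_le_mul hxθ hyθ hy H.θo_nonneg
  rcases he with rfl | ⟨rfl, h⟩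
  · have h1 := H.even_odd
    have h2 := mul_le_mul_of_nonneg_left hxy hΛ
    have h3 := H.le_odd
    exact vertexGe_even_of_pos hx hy hΛ hb hf le_rfl (by linarith) (by linarith) (by linarith)
  · refine vertexGe_even_of_neg hx hy (by linarith) hΛ hΛ1 hb hf le_rfl
      (by linarith) (by linarith) ?_
    have e3 := mul_le_mul_of_nonneg_right hΛ1 hx
    have e4 := mul_le_mul_of_nonneg_right hΛ1 H.θe_nonneg
    have e5 := mul_nonneg hB (show 0 ≤ 1 - 2 * x by linarith)
    have e1 : 0 ≤ (θe - y) * ((1 + B) * (1 - 2 * x) - Λ * x) :=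
      mul_nonneg (by linarith) (by linarith)
    have e2 : 0 ≤ (θo - x) * (2 * (1 - θe * (1 + B)) - Λ * θe) :=
      mul_nonneg (by linarith) (by linarith)
    have := h.even_odd
    linarith

theorem vertexGe_even_even (hx : 0 ≤ x) (hy : 0 ≤ y) (hyθ : y ≤ θe) (hxθ : x ≤ θe)
    (hb : |b| ≤ y * B) (hf : |f| ≤ x * B) (he : e = 1 ∨ (e = -1 ∧ NegBounds N Λ θo θe θ B)) :
    VertexGe e x y b f Λ := by
  have hB := H.B_nonneg
  have hB1 := H.B_le
  have hyB : y * (1 + B) ≤ θe * (1 + B) := mul_le_mul_of_nonneg_right hyθ (by linarith)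
  have hxB : x * (1 + B) ≤ θe * (1 + B) := mul_le_mul_of_nonneg_right hxθ (by linarith)
  have hxB' : x * B ≤ x := mul_le_of_le_one_right hx (by linarith)
  have hΛ := H.Λ_nonneg
  have hΛ1 := H.le_one
  have hee := H.even_le
  have hem := H.even_mul_le
  have h3 := H.le_even
  have hxy : x * y ≤ θe * θe := mul_le_mul hxθ hyθ hy H.θe_nonneg
  rcases he with rfl | ⟨rfl, h⟩
  · have h1 := H.even_even
    have h2 := mul_le_mul_of_nonneg_left hxy hΛ
    exact vertexGe_even_of_pos hx hy hΛ hb hf hxB' (by linarith) (by linarith) (by linarith)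
  · refine vertexGe_even_of_neg hx hy (by linarith) hΛ hΛ1 hb hf hxB'
      (by linarith) (by linarith) ?_
    have e1 : (1 - θe * (1 + B)) * (1 - θe * (1 + B)) ≤ (1 - y * (1 + B)) * (1 - x - x * B) :=
      mul_le_mul (by linarith) (by linarith) (by linarith) (by linarith)
    have e2 := mul_nonneg hΛ (mul_nonneg hx hy)
    have := h.even_even
    linarith

theorem vertexGe_odd_odd (hx : 0 ≤ x) (hy : 0 ≤ y) (hyθ : y ≤ θo) (hxθ : x ≤ θo)
    (hb0 : y * (1 - B) ≤ b) (hb1 : b ≤ y * (1 + B)) (hf0 : -x ≤ f) (hf1 : f ≤ x * (B - 1))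
    (he : e = 1 ∨ (e = -1 ∧ NegBounds N Λ θo θe θ B)) :
    VertexGe e x y b f Λ := by
  have hB := H.B_nonneg
  have hB1 := H.B_le
  have hyB : y * B ≤ θo * B := mul_le_mul_of_nonneg_right hyθ hB
  have hxB : x * B ≤ θo * B := mul_le_mul_of_nonneg_right hxθ hB
  have hxB' : x * B ≤ x := mul_le_of_le_one_right hx (by linarith)
  have hΛ := H.Λ_nonneg
  have hΛ1 := H.le_one
  have ho := H.odd_le
  have hom := H.odd_mul_le
  have h3 := H.le_odd
  have hxy : x * y ≤ θo * θo := mul_le_mul hxθ hyθ hy H.θo_nonneg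
  have e1 : (1 - θo * B) * (1 - 2 * θo) ≤ (1 - y * B) * (1 - x - x) :=
    mul_le_mul (by linarith) (by linarith) (by linarith) (by linarith)
  rcases he with rfl | ⟨rfl, h⟩
  · have h1 := H.odd_odd
    have h4 := H.odd_large
    have h2 := mul_le_mul_of_nonneg_left hxy hΛ
    exact vertexGe_odd_of_pos hx hy hB (by linarith) hΛ hb0 hb1 hf0 (by linarith)
      (by linarith) (by linarith) (by linarith)
  · have h4 := H.le_prod_odd
    refine vertexGe_odd_of_neg hx hy hB (by linarith) hΛ hΛ1 hb0 hb1 hf0 (by linarith)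
      (by linarith) (by linarith) ?_ (by linarith)
    have e2 := mul_nonneg hΛ (mul_nonneg hx hy)
    have e4 : (1 - θo * (2 + B)) * (1 - θo * B) ≤ (1 - y - b) * (1 - x - f) :=
      mul_le_mul (by linarith) (by linarith) (by linarith) (by linarith)
    have := h.odd_odd
    linarith

theorem vertexGe_odd_even {r : ℝ} (hx : 0 ≤ x) (hy : 0 ≤ y) (hyθ : y ≤ θo) (hxθ : x ≤ θe)
    (hr : |r| ≤ B) (hf0 : -(x * B) ≤ f) (hf1 : f ≤ 0)
    (he : e = 1 ∨ (e = -1 ∧ Λ * (1 - x * y) ≤ (1 - y * (2 + r)) * (1 - x))) :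
    VertexGe e x y (y * (1 + r)) f Λ := by
  rw [abs_le] at hr
  have hB := H.B_nonneg
  have hB1 := H.B_le
  have hb0 : y * (1 - B) ≤ y * (1 + r) := mul_le_mul_of_nonneg_left (by linarith) hy
  have hb1 : y * (1 + r) ≤ y * (1 + B) := mul_le_mul_of_nonneg_left (by linarith) hy
  have hyB : y * B ≤ θo * B := mul_le_mul_of_nonneg_right hyθ hB
  have hxB : x * (1 + B) ≤ θe * (1 + B) := mul_le_mul_of_nonneg_right hxθ (by linarith)
  have hxB' : x * B ≤ x := mul_le_of_le_one_right hx (by linarith)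
  have hΛ := H.Λ_nonneg
  have hΛ1 := H.le_one
  have ho := H.odd_le
  have hom := H.odd_mul_le
  have hee := H.even_le
  have hem := H.even_mul_le
  have h3 := H.le_even
  have hxy : x * y ≤ θe * θo := mul_le_mul hxθ hyθ hy H.θe_nonneg
  have e1 : (1 - θo * B) * (1 - θe * (1 + B)) ≤ (1 - y * B) * (1 - x - x * B) :=
    mul_le_mul (by linarith) (by linarith) (by linarith) (by linarith)
  rcases he with rfl | ⟨rfl, h⟩
  · have h1 := H.odd_even
    have h4 := H.odd_large
    have h2 := mul_le_mul_of_nonneg_left hxy hΛ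
    exact vertexGe_odd_of_pos hx hy hB (by linarith) hΛ hb0 hb1 hf0 hf1
      (by linarith) (by linarith) (by linarith)
  · have h4 := H.le_prod_even
    refine vertexGe_odd_of_neg hx hy hB (by linarith) hΛ hΛ1 hb0 hb1 hf0 hf1
      (by linarith) (by linarith) ?_ (by linarith)
    have e2 : (1 - y * (2 + r)) * (1 - x) ≤ (1 - y * (2 + r)) * (1 - x - f) :=
      mul_le_mul_of_nonneg_left (by linarith) (by linarith)
    linarith

/-- The critical vertex for `ε_k = 1`. -/
theorem critical_pos (h : NegBounds N Λ θo θe θ B) {D r β : ℝ} (hx : x ≤ θe)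
    (hβ : β ≤ θ) (hD : N + β ≤ D) (hr : r ≤ β * (1 + B)) :
    Λ * (D - x) ≤ (D - 2 - r) * (1 - x) := by
  have h1 := H.le_even
  have h2 := mul_nonneg H.θe_nonneg H.B_nonneg
  have h3 := H.even_le
  have h4 := h.le_N
  have h5 := h.odd_even_pos
  have h6 := h.θe_le
  have hΛN : Λ ≤ N - 2 - θ * B := by
    by_contra! hlt
    have e5 := mul_lt_mul_of_pos_right hlt (show 0 < 1 - θe by linarith)
    have e6 := mul_nonneg H.Λ_nonneg (show 0 ≤ N + θ - 1 by linarith [H.θe_nonneg])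
    linarith
  exact critical_of_pos hx hβ H.B_nonneg H.Λ_nonneg (by linarith) hΛN hD hr h5

/-- The critical vertex for `ε_k = -1`. -/
theorem critical_neg (h : NegBounds N Λ θo θe θ B) {D r β : ℝ} (hx : x ≤ θe)
    (hβ : β ≤ θ) (hD : N - β ≤ D) (hr : r ≤ β * B) :
    Λ * (D - x) ≤ (D - 2 - r) * (1 - x) := by
  have h1 := H.le_even
  have h2 := mul_nonneg H.θe_nonneg H.B_nonneg
  have h3 := H.even_le
  have h4 := h.le_N
  have h5 := h.odd_even_neg
  have h6 := h.θ_le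
  have hΛN : Λ ≤ N - 2 - θ - θ * B := by
    by_contra! hlt
    have e5 := mul_lt_mul_of_pos_right hlt (show 0 < 1 - θe by linarith)
    have e6 := mul_nonneg H.Λ_nonneg (show 0 ≤ N - θ - 1 by linarith [H.θe_nonneg])
    linarith
  exact critical_of_neg hx hβ H.B_nonneg (by linarith) hΛN (by linarith) hD hr h5

end PosBounds

/-! ### The vertices of γ_* -/

namespace Expansion

variable {E : Expansion} {α γ : ℝ}

theorem VertexGe.le_grid {t : ℕ → ℤ} {f : ℕ → ℝ} {k : ℕ} {Λ : ℝ}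
    (hV : VertexGe (E.ε (k + 1)) (E.tail k) (E.back k) (E.backSum t k) (f k) Λ) {m l : ℝ}
    (hm : m = 1 ∨ m = -1) (hl : l = 1 ∨ l = -1) :
    Λ * E.detFactor k ≤ |E.gridX t k m l| * |E.gridY f k m l| := by
  obtain ⟨h1, h2, h3, h4⟩ := hV
  rw [← abs_mul, detFactor, gridX, gridY]
  rcases hm with rfl | rfl <;> rcases hl with rfl | rfl
  · refine le_trans ?_ (le_abs_self _); linarith
  · refine le_trans ?_ (neg_le_abs _); linarith
  · refine le_trans ?_ (neg_le_abs _); linarith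
  · refine le_trans ?_ (le_abs_self _); linarith

theorem abs_backSum_lam_le (h : E.IsExpansionOf α) {k : ℕ} {B : ℝ}
    (hB : |E.backSum E.lam k| ≤ B) :
    |E.backSum E.lam (k + 1)| ≤ E.back (k + 1) * (1 + B) ∧
      (Even (E.a (k + 1)) → |E.backSum E.lam (k + 1)| ≤ E.back (k + 1) * B) := by
  have hy := h.back_pos k
  have he : |(E.ε (k + 1) : ℝ)| = 1 := by
    rcases h.eps_cases (k + 1) with he | he <;> simp [he]
  rw [backSum, abs_mul, abs_of_pos hy]
  refine ⟨mul_le_mul_of_nonneg_left ((abs_sub _ _).trans (add_le_add (abs_lam_le_one _ _) ?_))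
    hy.le, fun hp => mul_le_mul_of_nonneg_left ?_ hy.le⟩
  · rwa [abs_mul, he, one_mul]
  · rw [lam_of_even hp, Int.cast_zero, zero_sub, abs_neg, abs_mul, he, one_mul]
    exact hB

/-- An odd quotient replaces a bound β for |b| by at most θo (1 + β), with fixed point B₀ < B; an
even one multiplies it by at most 1/3. In both cases the excess over B₀ shrinks by a factor 1/3. -/
theorem eventually_abs_backSum_lam_le (h : E.IsExpansionOf α) {θo θe B : ℝ}
    (hpar : ∀ᶠ k in atTop, (Odd (E.a (k + 1)) → E.tail k ≤ θo ∧ E.back (k + 1) ≤ θo) ∧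
      (Even (E.a (k + 1)) → E.tail k ≤ θe ∧ E.back (k + 1) ≤ θe))
    (hθo : 0 ≤ θo) (hθo' : θo ≤ 1 / 3) (hθe' : θe ≤ 1 / 3) (hB : θo * (1 + B) < B) :
    ∀ᶠ k in atTop, |E.backSum E.lam k| ≤ B := by
  set B₀ := θo / (1 - θo) with hB₀
  have hr : 0 < 1 - θo := by linarith
  have hBB : B₀ < B := by rw [hB₀, div_lt_iff₀ hr]; linarith
  have hfix : θo * (1 + B₀) = B₀ := by rw [hB₀]; field_simp; ring
  have hB₀n : 0 ≤ B₀ := by rw [hB₀]; positivity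
  have hmax : ∀ᶠ k in atTop, max (|E.backSum E.lam k| - B₀) 0 ≤ B - B₀ := by
    refine eventually_le_of_affine_recursion (ρ := 1 / 3) (s := 0) (by norm_num) (by norm_num)
      ?_ (by linarith)
    filter_upwards [hpar] with k hk
    have h1 := le_max_left (|E.backSum E.lam k| - B₀) 0
    have h2 := le_max_right (|E.backSum E.lam k| - B₀) 0
    set o := max (|E.backSum E.lam k| - B₀) 0
    have h3 := abs_backSum_lam_le h (show |E.backSum E.lam k| ≤ B₀ + o by linarith)
    rw [add_zero]
    refine max_le ?_ (by positivity)
    rcases Int.even_or_odd (E.a (k + 1)) with hp | hp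
    · have h4 := h3.2 hp
      have h5 := mul_le_mul_of_nonneg_right ((hk.2 hp).2.trans hθe')
        (show 0 ≤ B₀ + o by linarith)
      linarith
    · have h4 := h3.1
      have h5 := mul_le_mul_of_nonneg_right (hk.1 hp).2 (show 0 ≤ 1 + (B₀ + o) by linarith)
      have h6 := mul_le_mul_of_nonneg_right hθo' h2
      linarith
  filter_upwards [hmax] with k hk
  have := (le_max_left _ _).trans hk
  linarith

/-- The critical vertex of `γ_*` for an odd partial quotient followed by an even one. -/
theorem critical_star (h : E.IsExpansionOf α) {Λ N θo θe θ B τ : ℝ} (hpos : PosBounds Λ θo θe B)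
    (hneg : NegBounds N Λ θo θe θ B) {k : ℕ} (hτ : |τ| = 1) (hlam : (E.lam (k + 2) : ℝ) = τ)
    (hodd : Odd (E.a (k + 2))) (hN : N ≤ E.a (k + 2)) (hβ : E.back (k + 1) ≤ θ)
    (hb : |E.backSum E.lam k| ≤ B) (hx : E.tail (k + 2) ≤ θe) :
    Λ * (E.a (k + 2) + E.ε (k + 2) * E.back (k + 1) - E.tail (k + 2)) ≤
      (E.a (k + 2) + E.ε (k + 2) * E.back (k + 1) - 2 -
        -(E.ε (k + 2) * (τ * E.backSum E.lam (k + 1)))) * (1 - E.tail (k + 2)) := by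
  have hβ0 := h.back_pos k
  have hb1 := abs_backSum_lam_le h hb
  rcases h.eps_cases (k + 2) with he2 | he2
  · refine hpos.critical_pos hneg hx hβ ?_ ?_
    · rw [he2, Int.cast_one, one_mul]; linarith
    · refine le_trans ?_ hb1.1
      rw [he2, Int.cast_one, one_mul]
      refine (neg_le_abs _).trans_eq ?_
      rw [abs_mul, hτ, one_mul]
  · refine hpos.critical_neg hneg hx hβ ?_ ?_
    · rw [he2, Int.cast_neg, Int.cast_one]; linarith
    · rw [he2, Int.cast_neg, Int.cast_one]
      -- For ε = −1 the denominator is only N − β, so the sharper bound r ≤ β B is needed. An even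
      -- preceding quotient contributes no digit; an odd one has digit −τ by alternation, which even
      -- gives r ≤ β(B − 1).
      rcases Int.even_or_odd (E.a (k + 1)) with hq | hq
      · refine le_trans ?_ (hb1.2 hq)
        refine (le_abs_self _).trans_eq ?_
        rw [abs_neg, abs_mul, abs_neg, abs_one, one_mul, abs_mul, hτ, one_mul]
      · have hl1 : (E.lam (k + 1) : ℝ) = -τ := by
          rw [← hlam, lam_of_odd hq, lam_of_odd hodd, nextSign_succ_of_odd hodd]
          push_cast; ring
        have e6 : |E.ε (k + 1) * (τ * E.backSum E.lam k)| ≤ B := by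
          have : |(E.ε (k + 1) : ℝ)| = 1 := by
            rcases h.eps_cases (k + 1) with he | he <;> simp [he]
          rw [abs_mul, this, one_mul, abs_mul, hτ, one_mul]
          exact hb
        have hτsq : τ * τ = 1 := by rw [← abs_mul_abs_self, hτ, one_mul]
        have e7 : -(-1 * (τ * E.backSum E.lam (k + 1))) =
            E.back (k + 1) * (-1 - E.ε (k + 1) * (τ * E.backSum E.lam k)) := by
          rw [backSum, hl1]
          linear_combination -E.back (k + 1) * hτsq
        rw [e7]
        exact mul_le_mul_of_nonneg_left (by linarith [(abs_le.1 e6).1]) hβ0.le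

theorem eventually_vertexGe_star (h : E.IsExpansionOf α) (hx : ∀ᶠ k in atTop, E.tail k ≤ 1 / 2)
    {Λ N θo θe θ B : ℝ}
    (hpar : ∀ᶠ k in atTop, (Odd (E.a (k + 1)) → E.tail k ≤ θo ∧ E.back (k + 1) ≤ θo) ∧
      (Even (E.a (k + 1)) → E.tail k ≤ θe ∧ E.back (k + 1) ≤ θe))
    (hN : ∀ᶠ k in atTop, Odd (E.a k) → N ≤ E.a k)
    (hpos : PosBounds Λ θo θe B) (hneg : (∀ i, E.ε i = 1) ∨ NegBounds N Λ θo θe θ B) :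
    ∀ᶠ k in atTop, VertexGe (E.ε (k + 1)) (E.tail k) (E.back k) (E.backSum E.lam k)
      (E.starFwd k) Λ := by
  have hback := eventually_abs_backSum_lam_le h hpar hpos.θo_nonneg hpos.odd_le hpos.even_le
    hpos.contract
  have hfwd := eventually_nextSign_mul_starFwd_mem h hx
  obtain ⟨K, hK⟩ := eventually_atTop.1 (((hpar.and hN).and hback).and hfwd)
  -- The shift by 2 makes room for the two earlier levels inspected by `critical_star`.
  refine eventually_atTop.2 ⟨K + 2, fun k hk => ?_⟩
  obtain ⟨k, rfl⟩ : ∃ j, k = j + 2 := ⟨k - 2, by omega⟩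
  have hb0 := (hK k (by omega)).1.2
  have hp1 := (hK k (by omega)).1.1.1
  obtain ⟨⟨⟨hp2, -⟩, hb1⟩, -⟩ := hK (k + 1) (by omega)
  obtain ⟨⟨⟨hp3, hN2⟩, -⟩, hf2⟩ := hK (k + 2) (by omega)
  obtain ⟨⟨⟨hp4, -⟩, -⟩, hf3⟩ := hK (k + 3) (by omega)
  clear hK hpar hN hback hfwd hk
  have hfs := starFwd_eq h hx (k + 2)
  have hx2 := (h.tail_pos (k + 2)).le
  have hy2 := (h.back_pos (k + 1)).le
  have hsabs : ∀ j, |(E.nextSign j : ℝ)| = 1 := by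
    intro j
    rcases E.nextSign_cases j with hs | hs <;> simp [hs]
  have hx3B : E.tail (k + 3) ≤ B := by
    rcases Int.even_or_odd (E.a (k + 3 + 1)) with hq | hq
    · exact (hp4.2 hq).1.trans hpos.θe_le
    · exact (hp4.1 hq).1.trans hpos.θo_le
  have habs3 : |E.starFwd (k + 3)| ≤ B := by
    rw [← one_mul |E.starFwd (k + 3)|, ← hsabs (k + 3), ← abs_mul, abs_of_nonneg hf3.1]
    exact hf3.2.trans hx3B
  have habs2 : |E.starFwd (k + 2)| ≤ E.tail (k + 2) := by
    rw [← one_mul |E.starFwd (k + 2)|, ← hsabs (k + 2), ← abs_mul, abs_of_nonneg hf2.1]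
    exact hf2.2
  have habs2e : Even (E.a (k + 3)) → |E.starFwd (k + 2)| ≤ E.tail (k + 2) * B := by
    intro hq
    rw [hfs, lam_of_even hq, Int.cast_zero, zero_add, abs_mul, abs_of_nonneg hx2]
    exact mul_le_mul_of_nonneg_left habs3 hx2
  have heps : (E.ε (k + 3) : ℝ) = 1 ∨ ((E.ε (k + 3) : ℝ) = -1 ∧ NegBounds N Λ θo θe θ B) := by
    rcases h.eps_cases (k + 3) with he | he
    · left; simp [he]
    · right
      rcases hneg with hneg | hneg
      · rw [hneg] at he; norm_num at he
      · exact ⟨by simp [he], hneg⟩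
  rcases Int.even_or_odd (E.a (k + 2)) with hq2 | hq2
  · have hb2 := (abs_backSum_lam_le h hb1).2 hq2
    rcases Int.even_or_odd (E.a (k + 3)) with hq3 | hq3
    · exact hpos.vertexGe_even_even hx2 hy2 (hp2.2 hq2).2 (hp3.2 hq3).1 hb2 (habs2e hq3) heps
    · exact hpos.vertexGe_even_odd hx2 hy2 (hp2.2 hq2).2 (hp3.1 hq3).1 hb2 habs2 heps
  -- The quotient at this level is odd with digit τ. Multiplied by τ, the backward sum becomes y(1 +
  -- r) with |r| ≤ B, and the forward sum is at most 0.
  set τ : ℝ := -(E.nextSign (k + 2) : ℝ) with hτ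
  have hτabs : |τ| = 1 := by rw [hτ, abs_neg, hsabs]
  have hτc : τ = 1 ∨ τ = -1 := eq_or_eq_neg_of_abs_eq hτabs
  have hτsq : τ * τ = 1 := by rw [← abs_mul_abs_self, hτabs, one_mul]
  have hlam : (E.lam (k + 2) : ℝ) = τ := by rw [lam_of_odd hq2, hτ]; push_cast; rfl
  have heabs : |(E.ε (k + 2) : ℝ)| = 1 := by
    rcases h.eps_cases (k + 2) with he | he <;> simp [he]
  set r : ℝ := -(E.ε (k + 2) * (τ * E.backSum E.lam (k + 1))) with hr
  have hrB : |r| ≤ B := by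
    rw [hr, abs_neg, abs_mul, heabs, abs_mul, hτabs, one_mul, one_mul]
    exact hb1
  have hbr : τ * E.backSum E.lam (k + 2) = E.back (k + 2) * (1 + r) := by
    rw [backSum, hlam, hr]
    linear_combination E.back (k + 2) * hτsq
  have hf0 : τ * E.starFwd (k + 2) ≤ 0 := by rw [hτ]; linarith [hf2.1]
  have hτf : |τ * E.starFwd (k + 2)| = |E.starFwd (k + 2)| := by rw [abs_mul, hτabs, one_mul]
  refine VertexGe.of_sign hτc ?_
  rw [hbr]
  rcases Int.even_or_odd (E.a (k + 3)) with hq3 | hq3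
  · have hg : -(E.tail (k + 2) * B) ≤ τ * E.starFwd (k + 2) := by
      have := habs2e hq3
      rw [← hτf] at this
      exact (abs_le.1 this).1
    refine hpos.vertexGe_odd_even hx2 hy2 (hp2.1 hq2).2 (hp3.2 hq3).1 hrB hg hf0
      (heps.imp_right fun he => ⟨he.1, ?_⟩)
    refine critical_vertex (h.back_succ_mul (k + 1)) hy2 ?_
    refine critical_star h hpos he.2 hτabs hlam hq2 (hN2 hq2) ?_ hb0 (hp3.2 hq3).1
    rcases Int.even_or_odd (E.a (k + 1)) with hq | hq
    · exact (hp1.2 hq).2.trans he.2.θe_le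
    · exact (hp1.1 hq).2.trans he.2.θo_le
  · have hg : -E.tail (k + 2) ≤ τ * E.starFwd (k + 2) := by
      have := habs2
      rw [← hτf] at this
      exact (abs_le.1 this).1
    have hrB' := abs_le.1 hrB
    have hs3 : (E.nextSign (k + 3) : ℝ) = τ := by
      rw [nextSign_succ_of_odd hq3, hτ]; push_cast; rfl
    have hf4 : τ * E.starFwd (k + 2) ≤ E.tail (k + 2) * (B - 1) := by
      have e3 : τ * E.starFwd (k + 2) =
          E.tail (k + 2) * (E.nextSign (k + 3) * E.starFwd (k + 3) - 1) := by
        rw [hfs, lam_of_odd hq3]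
        push_cast
        rw [hs3]
        linear_combination -E.tail (k + 2) * hτsq
      rw [e3]
      exact mul_le_mul_of_nonneg_left (by linarith [hf3.2]) hx2
    exact hpos.vertexGe_odd_odd hx2 hy2 (hp2.1 hq2).2 (hp3.1 hq3).1
      (mul_le_mul_of_nonneg_left (by linarith) hy2) (mul_le_mul_of_nonneg_left (by linarith) hy2)
      hg hf4 heps

end Expansion

/-! ### Numerical conditions as polynomial inequalities in s -/

/-- Here R = R_* = s + 5 and θo = 1/(R − 4/19). The first summand of Λ is κ = (R − 3)/(R − 2θo), the
second is 4 R_*⁻³, and B = 1/(R − 5/4) lies slightly above θo/(1 − θo). Cleared of denominators,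
each difference is visibly nonnegative for s ≥ 0. -/
theorem posBounds_nearest_odd {s : ℝ} (hs : 0 ≤ s) :
    PosBounds ((s + 2) * (19 * s + 91) / (19 * s ^ 2 + 186 * s + 417) + 4 / (s + 5) ^ 3)
      (19 / (19 * s + 91)) (19 / (19 * s + 110)) (4 / (4 * s + 15)) := by
  refine ⟨by positivity, by positivity, by positivity, ?_, ?_, ?_, ?_, ?_, ?_, ?_, ?_, ?_⟩
  -- This is `contract`, the only strict inequality of the list.
  case refine_4 =>
    field_simp
    rw [← sub_pos]
    ring_nf
    positivity
  all_goals
    field_simp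
    rw [← sub_nonneg]
    ring_nf
    positivity

theorem negBounds_nearest_odd {s : ℝ} (hs : 0 ≤ s) :
    NegBounds (s + 5)
      ((s + 2) * (19 * s + 91) / (19 * s ^ 2 + 186 * s + 417) + 4 / (s + 5) ^ 3)
      (19 / (19 * s + 91)) (19 / (19 * s + 110)) (19 / (19 * s + 91)) (4 / (4 * s + 15)) := by
  refine ⟨le_rfl, ?_, ?_, by linarith, ?_, ?_, ?_, ?_, ?_⟩
  all_goals
    field_simp
    rw [← sub_nonneg]
    ring_nf
    positivity

/-- Here R = s + 6 and R_* = s + 7, so odd quotients obey the better bound θo = 1/(R_* − 4/19),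
while κ = (R − 3)/(R − 2θe) with θe = 1/(R − 4/19). -/
theorem posBounds_nearest_even {s : ℝ} (hs : 0 ≤ s) :
    PosBounds ((s + 3) * (19 * s + 110) / (19 * s ^ 2 + 224 * s + 622) + 4 / (s + 7) ^ 3)
      (19 / (19 * s + 129)) (19 / (19 * s + 110)) (4 / (4 * s + 23)) := by
  refine ⟨by positivity, by positivity, by positivity, ?_, ?_, ?_, ?_, ?_, ?_, ?_, ?_, ?_⟩
  case refine_4 =>
    field_simp
    rw [← sub_pos]
    ring_nf
    positivity
  all_goals
    field_simp
    rw [← sub_nonneg]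
    ring_nf
    positivity

theorem negBounds_nearest_even {s : ℝ} (hs : 0 ≤ s) :
    NegBounds (s + 7)
      ((s + 3) * (19 * s + 110) / (19 * s ^ 2 + 224 * s + 622) + 4 / (s + 7) ^ 3)
      (19 / (19 * s + 129)) (19 / (19 * s + 110)) (19 / (19 * s + 110)) (4 / (4 * s + 23)) := by
  refine ⟨?_, le_rfl, ?_, by linarith, ?_, ?_, ?_, ?_, ?_⟩
  all_goals
    field_simp
    rw [← sub_nonneg]
    ring_nf
    positivity

/-- For R = 4 and R_* = 5 the tail bound 3/11 gives θo = 1/(5 − 3/11) and θe = 1/(4 − 3/11). The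
value κ = 9/25 is the threshold of the digit estimate; it exceeds (R − 3)/(R − 2θe) = 41/142. -/
theorem posBounds_nearest_four : PosBounds (9 / 25 + 4 / 125) (11 / 52) (11 / 41) (3 / 11) := by
  constructor <;> norm_num

theorem negBounds_nearest_four :
    NegBounds 5 (9 / 25 + 4 / 125) (11 / 52) (11 / 41) (11 / 41) (3 / 11) := by
  constructor <;> norm_num

/-- Here R_* = s + 5 and κ = (R_* − 3)/(R_* − 1). With all signs positive the tails are at most 1/a.
-/
theorem posBounds_regular {s : ℝ} (hs : 0 ≤ s) :
    PosBounds ((s + 2) / (s + 4) + 4 / (s + 5) ^ 3) (1 / (s + 5)) (1 / (s + 4))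
      (4 / (4 * s + 15)) := by
  refine ⟨by positivity, by positivity, by positivity, ?_, ?_, ?_, ?_, ?_, ?_, ?_, ?_, ?_⟩
  case refine_4 =>
    field_simp
    rw [← sub_pos]
    ring_nf
    positivity
  all_goals
    field_simp
    rw [← sub_nonneg]
    ring_nf
    positivity


/-! ### Both expansions satisfy the common properties -/

theorem irrational_distInt {x : ℝ} (hx : Irrational x) : Irrational (distInt x) := by
  rw [distInt]
  rcases abs_choice (x - round x) with h | h <;> rw [h]
  · exact hx.sub_intCast _
  · exact (hx.sub_intCast _).neg

theorem distInt_mem_Ioo {x : ℝ} (hx : Irrational x) : 0 < distInt x ∧ distInt x < 1 / 2 := by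
  have h := irrational_distInt hx
  refine ⟨lt_of_le_of_ne (abs_nonneg _) (by simpa using (h.ne_int 0).symm),
    lt_of_le_of_ne (abs_sub_round x) ?_⟩
  have := h.ne_rat (1 / 2)
  push_cast at this
  exact this

theorem nearestTail_spec {α : ℝ} (hα : Irrational α) (hα0 : 0 < α) (hα1 : α < 1 / 2) (i : ℕ) :
    Irrational (nearestTail α i) ∧ 0 < nearestTail α i ∧ nearestTail α i < 1 / 2 := by
  induction i with
  | zero => exact ⟨hα, hα0, hα1⟩
  | succ i ih => exact ⟨irrational_distInt ih.1.inv, distInt_mem_Ioo ih.1.inv⟩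

theorem isExpansionOf_nearest {α : ℝ} (hα : Irrational α) (hα0 : 0 < α) (hα1 : α < 1 / 2) :
    (nearest α).IsExpansionOf α := by
  have hs := nearestTail_spec hα hα0 hα1
  have htwo : ∀ i, 2 ≤ (nearest α).a (i + 1) := by
    intro i
    obtain ⟨-, h0, h1⟩ := hs i
    have h2 : 2 < (nearestTail α i)⁻¹ := by
      rw [lt_inv_comm₀ two_pos h0]; linarith
    have h3 : (2 : ℤ) ≤ ⌊(nearestTail α i)⁻¹⌋ := Int.le_floor.2 (by exact_mod_cast h2.le)
    simp only [nearest]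
    split_ifs
    · exact h3
    · exact h3.trans (Int.floor_le_ceil _)
  refine ⟨rfl, rfl, rfl, ?_, fun i => (hs i).2.1, fun i => (hs i).2.2.trans (by norm_num), ?_,
    fun i => by linarith [htwo i], fun i _ => htwo i⟩
  · rintro (_ | _ | i)
    · exact Or.inl rfl
    · exact Or.inl rfl
    · simp only [nearest]
      split_ifs <;> simp
  · intro i
    have hmin : distInt (nearestTail α i)⁻¹ = min (Int.fract (nearestTail α i)⁻¹)
        (1 - Int.fract (nearestTail α i)⁻¹) := abs_sub_round_eq_min _
    have hfl := Int.floor_add_fract (nearestTail α i)⁻¹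
    have hirr := (hs i).1.inv
    simp only [nearest, nearestTail]
    split_ifs with hc
    · rw [hc]; push_cast; linarith
    · have hd : distInt (nearestTail α i)⁻¹ = 1 - Int.fract (nearestTail α i)⁻¹ := by
        rw [hmin] at hc ⊢
        exact (min_choice _ _).resolve_left hc
      have hceil : ⌈(nearestTail α i)⁻¹⌉ = ⌊(nearestTail α i)⁻¹⌋ + 1 := by
        rw [Int.ceil_eq_floor_add_one_iff_notMem]
        rintro ⟨z, hz⟩
        exact hirr.ne_int z hz.symm
      rw [hd, hceil]; push_cast; linarith

theorem regularTail_spec {α : ℝ} (hα : Irrational α) (hα0 : 0 < α) (hα1 : α < 1) (i : ℕ) :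
    Irrational (regularTail α i) ∧ 0 < regularTail α i ∧ regularTail α i < 1 := by
  induction i with
  | zero => exact ⟨hα, hα0, hα1⟩
  | succ i ih =>
    have h : Irrational (regularTail α (i + 1)) := ih.1.inv.sub_intCast _
    exact ⟨h, lt_of_le_of_ne (Int.fract_nonneg _) (by simpa using (h.ne_int 0).symm),
      Int.fract_lt_one _⟩

theorem isExpansionOf_regular {α : ℝ} (hα : Irrational α) (hα0 : 0 < α) (hα1 : α < 1) :
    (regular α).IsExpansionOf α := by
  have hs := regularTail_spec hα hα0 hα1
  refine ⟨rfl, rfl, rfl, fun _ => Or.inl rfl, fun i => (hs i).2.1, fun i => (hs i).2.2, ?_, ?_,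
    fun i hi => ?_⟩
  · intro i
    have := Int.floor_add_fract (regularTail α i)⁻¹
    simp only [regular, regularTail]
    push_cast
    linarith
  · intro i
    refine Int.le_floor.2 ?_
    exact_mod_cast (one_le_inv₀ (hs i).2.1).2 (hs i).2.2.le
  · simp [regular] at hi

/-! ### The digits of γ and the comparison with γ_* -/

namespace Expansion

variable {E : Expansion} {α : ℝ}

theorem gammaRem_mem (E : Expansion) (γ : ℝ) (k : ℕ) : 0 ≤ E.gammaRem γ k ∧ E.gammaRem γ k < 1 := by
  cases k <;> exact ⟨Int.fract_nonneg _, Int.fract_lt_one _⟩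

/-- The forward sum of the digits `t` of `γ`. -/
def digitFwd (E : Expansion) (γ : ℝ) (k : ℕ) : ℝ :=
  2 * E.gammaRem γ k - 1 - E.ε (k + 1) * E.tail k

theorem isDigitRep_t (h : E.IsExpansionOf α) (γ : ℝ) :
    E.IsDigitRep γ (E.t γ) (E.digitFwd γ) := by
  refine ⟨fun k => ?_, fun k => ?_, ⌊γ⌋, ?_⟩
  · rw [t]
    rcases h.eps_cases (k + 1) with he | he <;> rw [he]
    · exact ⟨E.c γ (k + 1) - E.a (k + 1), by ring⟩
    · exact ⟨E.c γ (k + 1) - E.a (k + 1) + 1, by ring⟩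
  · have h1 := Int.floor_add_fract (E.gammaRem γ k / E.tail k)
    have h2 : E.gammaRem γ k = E.tail k * (E.c γ (k + 1) + E.gammaRem γ (k + 1)) := by
      rw [c, gammaRem, h1, mul_div_cancel₀ _ (h.tail_pos k).ne']
    have h3 := h.tail_mul k
    rw [digitFwd, digitFwd, t]
    push_cast
    linear_combination 2 * h2 + h3
  · have h1 := Int.floor_add_fract γ
    rw [digitFwd, h.eps_one, gammaRem]
    push_cast
    linarith

theorem digitFwd_mem (E : Expansion) (γ : ℝ) (k : ℕ) :
    -1 - E.ε (k + 1) * E.tail k ≤ E.digitFwd γ k ∧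
      E.digitFwd γ k < 1 - E.ε (k + 1) * E.tail k := by
  have := E.gammaRem_mem γ k
  rw [digitFwd]
  constructor <;> linarith

/-- From 0 ≤ c_i and c_i < 1/α_{i−1}. This crude range is the input of `overflow_succ_le`. -/
theorem t_mem (h : E.IsExpansionOf α) (γ : ℝ) (k : ℕ) :
    -E.a (k + 1) + 1 - E.ε (k + 1) ≤ E.t γ (k + 1) ∧
      E.t γ (k + 1) ≤ E.a (k + 1) - E.ε (k + 1) + E.ε (k + 2) := by
  have hr := E.gammaRem_mem γ k
  have htp := h.tail_pos k
  have h0 : 0 ≤ E.c γ (k + 1) := Int.floor_nonneg.2 (by have := hr.1; positivity)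
  have h1 : (E.c γ (k + 1) : ℝ) < E.a (k + 1) + E.ε (k + 2) * E.tail (k + 1) := by
    refine (Int.floor_le (E.gammaRem γ k / E.tail k)).trans_lt ?_
    rw [← h.tail_inv, div_eq_mul_inv]
    exact mul_lt_of_lt_one_left (inv_pos.2 htp) hr.2
  have h2 := h.tail_pos (k + 1)
  have h3 := h.tail_lt_one (k + 1)
  rw [t]
  refine ⟨by linarith, ?_⟩
  rcases h.eps_cases (k + 2) with he | he <;> rw [he] at h1 ⊢
  · have : E.c γ (k + 1) < E.a (k + 1) + 1 := by
      have : (E.c γ (k + 1) : ℝ) < E.a (k + 1) + 1 := by push_cast at h1; linarith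
      exact_mod_cast this
    linarith
  · have : E.c γ (k + 1) < E.a (k + 1) := by
      have : (E.c γ (k + 1) : ℝ) < E.a (k + 1) := by push_cast at h1; linarith
      exact_mod_cast this
    linarith

/-- A lower bound for the approximation constant of `γ_*`. -/
theorem le_M_gammaStar (h : E.IsExpansionOf α) (ha : ∀ᶠ i in atTop, 4 ≤ E.a i)
    {Λ N θo θe θ B : ℝ}
    (hpar : ∀ᶠ k in atTop, (Odd (E.a (k + 1)) → E.tail k ≤ θo ∧ E.back (k + 1) ≤ θo) ∧
      (Even (E.a (k + 1)) → E.tail k ≤ θe ∧ E.back (k + 1) ≤ θe))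
    (hN : ∀ᶠ k in atTop, Odd (E.a k) → N ≤ E.a k)
    (hpos : PosBounds Λ θo θe B) (hneg : (∀ i, E.ε i = 1) ∨ NegBounds N Λ θo θe θ B) :
    ((Λ / 4 : ℝ) : EReal) ≤ M α (E.gammaStar α) := by
  have hx : ∀ᶠ k in atTop, E.tail k ≤ 1 / 2 :=
    (h.eventually_le_three_div_eleven ha).mono fun k hk => hk.1.trans (by norm_num)
  have hV := eventually_vertexGe_star h hx hpar hN hpos hneg
  refine (isDigitRep_gammaStar h hx).le_M h hpos.le_one ha (fun k => ?_) ?_ ?_ ?_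
  · exact_mod_cast E.abs_lam_le_one (k + 1)
  · filter_upwards [eventually_nextSign_mul_starFwd_mem h hx, hx] with k hk hk'
    rw [abs_le]
    rcases E.nextSign_cases k with hs | hs <;> rw [hs] at hk <;> push_cast at hk <;>
      constructor <;> linarith
  · filter_upwards [eventually_abs_backSum_lam_le h hpar hpos.θo_nonneg hpos.odd_le hpos.even_le
      hpos.contract] with k hk
    have := hpos.B_le
    linarith
  · filter_upwards [hV] with k hk m l hm hl
    exact VertexGe.le_grid hk hm hl

/-- The combination of the lower bound for `γ_*` with the upper bound for `γ`. -/
theorem eventually_digit_lt (h : E.IsExpansionOf α) (ha : ∀ᶠ i in atTop, 4 ≤ E.a i) {γ : ℝ}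
    (hγ : ∀ m n : ℤ, γ ≠ m + n * α) {Λ κ δ N θo θe θ B : ℝ}
    (hpar : ∀ᶠ k in atTop, (Odd (E.a (k + 1)) → E.tail k ≤ θo ∧ E.back (k + 1) ≤ θo) ∧
      (Even (E.a (k + 1)) → E.tail k ≤ θe ∧ E.back (k + 1) ≤ θe))
    (hN : ∀ᶠ k in atTop, Odd (E.a k) → N ≤ E.a k)
    (hpos : PosBounds Λ θo θe B) (hneg : (∀ i, E.ε i = 1) ∨ NegBounds N Λ θo θe θ B)
    (hκ : 9 / 25 ≤ κ) (hΛ : κ + 4 * δ ≤ Λ)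
    (hM : M α γ > M α (E.gammaStar α) - (δ : EReal)) :
    ∀ᶠ k in atTop, κ * (E.a (k + 1) + E.ε (k + 2) * E.tail (k + 1) + E.ε (k + 1) * E.back k) <
      E.a (k + 1) - |(E.t γ (k + 1) : ℝ)| := by
  have hc : ((κ / 4 : ℝ) : EReal) < M α γ := by
    refine lt_of_le_of_lt ?_ hM
    refine le_trans ?_ (EReal.sub_le_sub (le_M_gammaStar h ha hpar hN hpos hneg) le_rfl)
    rw [← EReal.coe_sub]
    exact EReal.coe_le_coe_iff.2 (by linarith)
  have hmain := (isDigitRep_t h γ).eventually_lt_sub_abs_digit h ha hγ (E.digitFwd_mem γ)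
    (t_mem h γ) (c := κ / 4) (by linarith) hc
  filter_upwards [hmain] with k hk
  rwa [mul_div_cancel₀ _ (four_ne_zero' ℝ)] at hk

theorem eventually_le_a_of_R {R : ℤ} (hR : E.R = ((R : ℝ) : EReal)) :
    ∀ᶠ i in atTop, R ≤ E.a i := by
  have h1 : (((R : ℝ) - 1 : ℝ) : EReal) < E.R := by
    rw [hR]
    exact EReal.coe_lt_coe_iff.2 (by linarith)
  filter_upwards [eventually_lt_of_lt_liminf h1] with i hi
  have : ((R - 1 : ℤ) : ℝ) < E.a i := by
    push_cast
    exact EReal.coe_lt_coe_iff.1 hi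
  have := Int.cast_lt.1 this
  omega


variable {E : Expansion} {α γ : ℝ}

theorem eventually_parity_bounds (h : E.IsExpansionOf α) {θ₀ N N' : ℝ}
    (hθ : ∀ᶠ k in atTop, E.tail k ≤ θ₀ ∧ E.back k ≤ θ₀)
    (hN : ∀ᶠ k in atTop, Odd (E.a k) → N ≤ E.a k)
    (hN' : ∀ᶠ k in atTop, Even (E.a k) → N' ≤ E.a k) (h1 : θ₀ < N) (h2 : θ₀ < N') :
    ∀ᶠ k in atTop,
      (Odd (E.a (k + 1)) → E.tail k ≤ (N - θ₀)⁻¹ ∧ E.back (k + 1) ≤ (N - θ₀)⁻¹) ∧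
      (Even (E.a (k + 1)) → E.tail k ≤ (N' - θ₀)⁻¹ ∧ E.back (k + 1) ≤ (N' - θ₀)⁻¹) := by
  filter_upwards [hθ, (tendsto_add_atTop_nat 1).eventually hθ,
    (tendsto_add_atTop_nat 1).eventually hN, (tendsto_add_atTop_nat 1).eventually hN']
    with k hk hk' hk1 hk2
  exact ⟨fun ho => ⟨h.tail_le (hk1 ho) hk'.1 h1, h.back_le (hk1 ho) hk.2 h1⟩,
    fun he => ⟨h.tail_le (hk2 he) hk'.1 h2, h.back_le (hk2 he) hk.2 h2⟩⟩

/-- Two rounds of θ ↦ 1/(5 − θ), from 1 to 1/4 to 4/19. -/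
theorem eventually_le_four_div_nineteen (h : E.IsExpansionOf α)
    (ha : ∀ᶠ i in atTop, 5 ≤ E.a i) : ∀ᶠ k in atTop, E.tail k ≤ 4 / 19 ∧ E.back k ≤ 4 / 19 := by
  have ha' : ∀ᶠ i in atTop, (5 : ℝ) ≤ E.a i := ha.mono fun i hi => by exact_mod_cast hi
  have h1 := h.eventually_tail_back_le (θ := 1) ha'
    (Eventually.of_forall fun k => ⟨(h.tail_lt_one k).le, (h.back_nonneg_le_one k).2⟩)
    (by norm_num)
  have h2 := h.eventually_tail_back_le ha' h1 (by norm_num)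
  rwa [show ((5 : ℝ) - (5 - 1)⁻¹)⁻¹ = 4 / 19 by norm_num] at h2

theorem oddCeil_le_of_odd {R a : ℤ} (h : R ≤ a) (ha : Odd a) : oddCeil R ≤ a := by
  rw [oddCeil]
  split_ifs with hR
  · exact h
  · rw [Int.not_odd_iff_even] at hR
    obtain ⟨m, rfl⟩ := ha
    obtain ⟨n, rfl⟩ := hR
    omega

theorem zpow_neg_three (x : ℝ) : x ^ (-3 : ℤ) = 1 / x ^ 3 := by
  rw [zpow_neg, one_div]
  norm_cast

/-- The digit bound under numerical conditions on the tails. -/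
theorem eventually_abs_t_lt (h : E.IsExpansionOf α) {R : ℤ} (hR : 4 ≤ R)
    (ha : ∀ᶠ i in atTop, R ≤ E.a i) (hγ : ∀ m n : ℤ, γ ≠ m + n * α) {κ θ₀ N N' B : ℝ}
    (hθ : ∀ᶠ k in atTop, E.tail k ≤ θ₀ ∧ E.back k ≤ θ₀) (h1 : θ₀ ≤ 1)
    (hN : ∀ᶠ k in atTop, Odd (E.a k) → N ≤ E.a k)
    (hN' : ∀ᶠ k in atTop, Even (E.a k) → N' ≤ E.a k) (hR1 : R ≤ N) (hR2 : R ≤ N')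
    (hpos : PosBounds (κ + 4 / N ^ 3) (N - θ₀)⁻¹ (N' - θ₀)⁻¹ B)
    (hneg : NegBounds N (κ + 4 / N ^ 3) (N - θ₀)⁻¹ (N' - θ₀)⁻¹ (R - θ₀)⁻¹ B)
    (hκ : 9 / 25 ≤ κ) (hκR : R - 3 ≤ κ * (R - 2 * (R - θ₀)⁻¹))
    (hM : M α γ > M α (E.gammaStar α) - ((N ^ (-3 : ℤ) : ℝ) : EReal)) :
    ∀ᶠ i in atTop, ((|E.t γ i| : ℤ) : ℝ) < 3 * (E.a i : ℝ) / (R : ℝ) := by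
  have hR' : (4 : ℝ) ≤ R := by exact_mod_cast hR
  have haR : ∀ᶠ i in atTop, (R : ℝ) ≤ E.a i := ha.mono fun i hi => by exact_mod_cast hi
  have hmain := eventually_digit_lt h (ha.mono fun i hi => hR.trans hi) hγ
    (eventually_parity_bounds h hθ hN hN' (by linarith) (by linarith)) hN hpos (Or.inr hneg) hκ
    (by rw [zpow_neg_three]; exact le_of_eq (by ring)) hM
  have hb := h.eventually_tail_back_le haR hθ (by linarith)
  suffices hs : ∀ᶠ k in atTop, ((|E.t γ (k + 1)| : ℤ) : ℝ) < 3 * (E.a (k + 1) : ℝ) / (R : ℝ) by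
    rw [eventually_atTop] at hs ⊢
    obtain ⟨K, hK⟩ := hs
    refine ⟨K + 1, fun i hi => ?_⟩
    obtain ⟨k, rfl⟩ : ∃ j, i = j + 1 := ⟨i - 1, by omega⟩
    exact hK k (by omega)
  filter_upwards [hmain, hb, (tendsto_add_atTop_nat 1).eventually hb,
    (tendsto_add_atTop_nat 1).eventually haR] with k hk hk0 hk1 hak
  set θ := (R - θ₀)⁻¹ with hθd
  have hx := h.tail_pos (k + 1)
  have hy := h.back_nonneg k
  have hθ0 : 0 ≤ θ := hx.le.trans hk1.1
  have hW : E.a (k + 1) - 2 * θ ≤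
      E.a (k + 1) + E.ε (k + 2) * E.tail (k + 1) + E.ε (k + 1) * E.back k := by
    have := hk0.2
    have := hk1.1
    rcases h.eps_cases (k + 2) with he | he <;> rcases h.eps_cases (k + 1) with he' | he' <;>
      rw [he, he'] <;> push_cast <;> linarith
  have hκ0 : 0 ≤ κ := by linarith
  have h3 := mul_le_mul_of_nonneg_left hW hκ0
  rw [lt_div_iff₀ (by linarith)]
  push_cast
  -- The hypothesis `hκR` is the wanted inequality for a = R; since κ R ≥ R − 3, it persists for all
  -- a ≥ R.
  have h4 : R - 3 ≤ κ * R := by nlinarith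
  have h5 : (E.a (k + 1) : ℝ) * (R - 3) ≤ R * (κ * (E.a (k + 1) - 2 * θ)) := by
    nlinarith [mul_le_mul_of_nonneg_left hκR (by linarith : (0 : ℝ) ≤ R),
      mul_nonneg (sub_nonneg.2 h4) (sub_nonneg.2 hak)]
  nlinarith [mul_lt_mul_of_pos_left (h3.trans_lt hk) (by linarith : (0 : ℝ) < R)]

/-- The parity of R decides whether the odd or the even quotients satisfy the better lower bound R +
1. The case R = 4 is separate, because there the tails are only known to be at most 3/11 instead of
4/19. -/
theorem eventually_abs_t_lt_of_R (h : E.IsExpansionOf α) {R : ℤ} (hR4 : 4 ≤ R)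
    (hR : E.R = ((R : ℝ) : EReal)) (hγ : ∀ m n : ℤ, γ ≠ m + n * α)
    (hM : M α γ > M α (E.gammaStar α) - ((((oddCeil R : ℤ) : ℝ) ^ (-3 : ℤ) : ℝ) : EReal)) :
    ∀ᶠ i in atTop, ((|E.t γ i| : ℤ) : ℝ) < 3 * (E.a i : ℝ) / (R : ℝ) := by
  have ha := eventually_le_a_of_R hR
  have hN : ∀ᶠ k in atTop, Odd (E.a k) → ((oddCeil R : ℤ) : ℝ) ≤ E.a k :=
    ha.mono fun k hk ho => by exact_mod_cast oddCeil_le_of_odd hk ho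
  rcases Int.even_or_odd R with hp | hp
  · have hN' : ∀ᶠ k in atTop, Even (E.a k) → (R : ℝ) ≤ E.a k :=
      ha.mono fun k hk _ => by exact_mod_cast hk
    have hodd : oddCeil R = R + 1 := if_neg (Int.not_odd_iff_even.2 hp)
    rw [hodd] at hM hN
    rcases hR4.eq_or_lt with rfl | hR5
    · have hθ := h.eventually_le_three_div_eleven ha
      refine eventually_abs_t_lt h le_rfl ha hγ (κ := 9 / 25) (B := 3 / 11) hθ (by norm_num) hN hN' (by norm_num) le_rfl ?_ ?_ le_rfl (by norm_num) hM
      · convert posBounds_nearest_four using 1 <;> norm_num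
      · convert negBounds_nearest_four using 1 <;> norm_num
    · have hR6 : 6 ≤ R := by
        obtain ⟨m, rfl⟩ := hp
        omega
      obtain ⟨s, hs, hsR⟩ : ∃ s : ℝ, 0 ≤ s ∧ (R : ℝ) = s + 6 :=
        ⟨R - 6, by have : (6 : ℝ) ≤ R := by exact_mod_cast hR6
                   linarith, by ring⟩
      have hθ := eventually_le_four_div_nineteen h (ha.mono fun i hi => by omega)
      have e1 : ((R + 1 : ℤ) : ℝ) = s + 7 := by push_cast; linarith
      have e2 : (s + 7 - 4 / 19)⁻¹ = 19 / (19 * s + 129) := by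
        rw [inv_eq_one_div, div_eq_div_iff (by linarith) (by linarith)]; ring
      have e3 : (s + 6 - 4 / 19)⁻¹ = 19 / (19 * s + 110) := by
        rw [inv_eq_one_div, div_eq_div_iff (by linarith) (by linarith)]; ring
      refine eventually_abs_t_lt h hR4 ha hγ (B := 4 / (4 * s + 23))
        (κ := (s + 3) * (19 * s + 110) / (19 * s ^ 2 + 224 * s + 622)) hθ (by norm_num) hN hN' (by push_cast; linarith) le_rfl ?_ ?_ ?_ ?_ hM
      · rw [e1, hsR, e2, e3]
        exact posBounds_nearest_even hs
      · rw [e1, hsR, e2, e3]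
        exact negBounds_nearest_even hs
      · rw [div_le_div_iff₀ (by norm_num) (by positivity)]
        nlinarith
      · rw [hsR, e3]
        field_simp
        rw [← sub_nonneg]
        ring_nf
        positivity
  · have hN' : ∀ᶠ k in atTop, Even (E.a k) → ((R : ℝ) + 1) ≤ E.a k :=
      ha.mono fun k hk he => by
        have : R + 1 ≤ E.a k := by
          obtain ⟨m, hm⟩ := hp
          obtain ⟨n, hn⟩ := he
          omega
        exact_mod_cast this
    have hodd : oddCeil R = R := if_pos hp
    rw [hodd] at hM hN
    have hR5 : 5 ≤ R := by
      obtain ⟨m, rfl⟩ := hp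
      omega
    obtain ⟨s, hs, hsR⟩ : ∃ s : ℝ, 0 ≤ s ∧ (R : ℝ) = s + 5 :=
      ⟨R - 5, by have : (5 : ℝ) ≤ R := by exact_mod_cast hR5
                 linarith, by ring⟩
    have hθ := eventually_le_four_div_nineteen h (ha.mono fun i hi => by omega)
    have e2 : (s + 5 - 4 / 19)⁻¹ = 19 / (19 * s + 91) := by
      rw [inv_eq_one_div, div_eq_div_iff (by linarith) (by linarith)]; ring
    have e3 : (s + 5 + 1 - 4 / 19)⁻¹ = 19 / (19 * s + 110) := by
      rw [inv_eq_one_div, div_eq_div_iff (by linarith) (by linarith)]; ring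
    refine eventually_abs_t_lt h hR4 ha hγ (B := 4 / (4 * s + 15))
      (κ := (s + 2) * (19 * s + 91) / (19 * s ^ 2 + 186 * s + 417)) hθ (by norm_num) hN hN' le_rfl (by linarith) ?_ ?_ ?_ ?_ hM
    · rw [hsR, e2, e3]
      exact posBounds_nearest_odd hs
    · rw [hsR, e2, e3]
      exact negBounds_nearest_odd hs
    · rw [div_le_div_iff₀ (by norm_num) (by positivity)]
      nlinarith
    · rw [hsR, e2]
      field_simp
      rw [← sub_nonneg]
      ring_nf
      positivity

theorem eventually_abs_t_lt_of_eps_one (h : E.IsExpansionOf α) (hε : ∀ i, E.ε i = 1) {R : ℤ}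
    (hR4 : 4 ≤ R) (hR : E.R = ((R : ℝ) : EReal)) (hγ : ∀ m n : ℤ, γ ≠ m + n * α)
    (hM : M α γ > M α (E.gammaStar α) - ((((oddCeil R : ℤ) : ℝ) ^ (-3 : ℤ) : ℝ) : EReal)) :
    ∀ᶠ i in atTop, ((|E.t γ i| : ℤ) : ℝ) < 2 * (E.a i : ℝ) / ((oddCeil R : ℝ) - 1) := by
  have ha := eventually_le_a_of_R hR
  have hodd : Odd (oddCeil R) ∧ 5 ≤ oddCeil R ∧ oddCeil R ≤ R + 1 := by
    rw [oddCeil]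
    split_ifs with hp
    · exact ⟨hp, by obtain ⟨m, rfl⟩ := hp; omega, by omega⟩
    · exact ⟨(Int.not_odd_iff_even.1 hp).add_one, by omega, le_rfl⟩
  obtain ⟨-, hR5, hR1⟩ := hodd
  have hN : ∀ᶠ k in atTop, Odd (E.a k) → ((oddCeil R : ℤ) : ℝ) ≤ E.a k :=
    ha.mono fun k hk ho => by exact_mod_cast oddCeil_le_of_odd hk ho
  obtain ⟨s, hs, hsR⟩ : ∃ s : ℝ, 0 ≤ s ∧ ((oddCeil R : ℤ) : ℝ) = s + 5 :=
    ⟨oddCeil R - 5, by have : (5 : ℝ) ≤ oddCeil R := by exact_mod_cast hR5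
                       linarith, by ring⟩
  have haN : ∀ᶠ k in atTop, s + 4 ≤ (E.a k : ℝ) := ha.mono fun k hk => by
    have : oddCeil R ≤ E.a k + 1 := by omega
    have : ((oddCeil R : ℤ) : ℝ) ≤ E.a k + 1 := by exact_mod_cast this
    linarith
  rw [hsR] at hM hN ⊢
  have hle : ∀ k, ∀ A : ℝ, 0 < A → A ≤ E.a (k + 1) →
      E.tail k ≤ 1 / A ∧ E.back (k + 1) ≤ 1 / A := by
    intro k A hA hak
    have h1 := h.tail_mul k
    have h2 := h.back_succ_mul k
    have h3 := h.tail_pos k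
    have h4 := h.back_pos k
    have h5 := h.tail_pos (k + 1)
    have h6 := h.back_nonneg k
    rw [hε] at h1 h2
    push_cast at h1 h2
    rw [le_div_iff₀ hA, le_div_iff₀ hA]
    constructor <;> nlinarith
  have hpar : ∀ᶠ k in atTop,
      (Odd (E.a (k + 1)) → E.tail k ≤ 1 / (s + 5) ∧ E.back (k + 1) ≤ 1 / (s + 5)) ∧
      (Even (E.a (k + 1)) → E.tail k ≤ 1 / (s + 4) ∧ E.back (k + 1) ≤ 1 / (s + 4)) := by
    filter_upwards [(tendsto_add_atTop_nat 1).eventually hN,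
      (tendsto_add_atTop_nat 1).eventually haN] with k h1 h2
    exact ⟨fun ho => hle k _ (by linarith) (h1 ho), fun _ => hle k _ (by linarith) h2⟩
  have hmain := eventually_digit_lt (θ := 0) h (ha.mono fun i hi => hR4.trans hi) hγ hpar hN
    (posBounds_regular hs) (Or.inl hε) (κ := (s + 2) / (s + 4))
    (by rw [div_le_div_iff₀ (by norm_num) (by positivity)]; linarith)
    (by rw [zpow_neg_three]; exact le_of_eq (by ring)) hM
  suffices hs : ∀ᶠ k in atTop,
      ((|E.t γ (k + 1)| : ℤ) : ℝ) < 2 * (E.a (k + 1) : ℝ) / (s + 5 - 1) by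
    rw [eventually_atTop] at hs ⊢
    obtain ⟨K, hK⟩ := hs
    refine ⟨K + 1, fun i hi => ?_⟩
    obtain ⟨k, rfl⟩ : ∃ j, i = j + 1 := ⟨i - 1, by omega⟩
    exact hK k (by omega)
  filter_upwards [hmain] with k hk
  have hx := h.tail_pos (k + 1)
  have hy := h.back_nonneg k
  rw [hε, hε] at hk
  push_cast at hk ⊢
  -- Both tails enter W with a plus sign, so W ≥ a, and 1 − κ = 2/(R_* − 1).
  have h1 : (s + 2) / (s + 4) * E.a (k + 1) < E.a (k + 1) - |(E.t γ (k + 1) : ℝ)| := by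
    refine lt_of_le_of_lt (mul_le_mul_of_nonneg_left ?_ (by positivity)) hk
    linarith
  rw [div_mul_eq_mul_div, div_lt_iff₀ (by linarith)] at h1
  rw [lt_div_iff₀ (by linarith)]
  linarith

theorem even_t_sub_a (h : E.IsExpansionOf α) (γ : ℝ) {k : ℕ} (hk : 1 ≤ k) :
    Even (E.t γ k - E.a k) := by
  obtain ⟨j, rfl⟩ : ∃ j, k = j + 1 := ⟨k - 1, by omega⟩
  exact (isDigitRep_t h γ).parity j

end Expansion

end InhomApprox

end

/-! ### The two parts of the theorem; parity at the minimal quotients -/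

theorem theorem7 (α γ : ℝ) (hα : Irrational α) (hα0 : 0 < α) (hα1 : α < 1 / 2)
    (hγ : ∀ m n : ℤ, γ ≠ m + n * α) :
    (∀ R : ℤ, 4 ≤ R → (InhomApprox.nearest α).R = ((R : ℝ) : EReal) →
      InhomApprox.M α γ > InhomApprox.M α ((InhomApprox.nearest α).gammaStar α)
        - ((((InhomApprox.oddCeil R : ℤ) : ℝ) ^ (-3 : ℤ) : ℝ) : EReal) →
      (∀ᶠ i : ℕ in Filter.atTop,
        ((|(InhomApprox.nearest α).t γ i| : ℤ) : ℝ)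
          < 3 * ((InhomApprox.nearest α).a i : ℝ) / (R : ℝ)) ∧
      (∀ᶠ k : ℕ in Filter.atTop, (InhomApprox.nearest α).a k = R →
        (Odd ((InhomApprox.nearest α).a k) →
          (InhomApprox.nearest α).t γ k = 1 ∨ (InhomApprox.nearest α).t γ k = -1) ∧
        (Even ((InhomApprox.nearest α).a k) →
          (InhomApprox.nearest α).t γ k = 0 ∨ (InhomApprox.nearest α).t γ k = 2 ∨
            (InhomApprox.nearest α).t γ k = -2))) ∧
    (∀ R : ℤ, 4 ≤ R → (InhomApprox.regular α).R = ((R : ℝ) : EReal) →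
      InhomApprox.M α γ > InhomApprox.M α ((InhomApprox.regular α).gammaStar α)
        - ((((InhomApprox.oddCeil R : ℤ) : ℝ) ^ (-3 : ℤ) : ℝ) : EReal) →
      (∀ᶠ i : ℕ in Filter.atTop,
        ((|(InhomApprox.regular α).t γ i| : ℤ) : ℝ)
          < 2 * ((InhomApprox.regular α).a i : ℝ) / ((InhomApprox.oddCeil R : ℝ) - 1)) ∧
      (∀ᶠ k : ℕ in Filter.atTop, (InhomApprox.regular α).a k = R →
        (Odd ((InhomApprox.regular α).a k) →
          (InhomApprox.regular α).t γ k = 1 ∨ (InhomApprox.regular α).t γ k = -1) ∧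
        (Even ((InhomApprox.regular α).a k) → (InhomApprox.regular α).t γ k = 0))) := by
  constructor
  · intro R hR4 hR hM
    have h := InhomApprox.isExpansionOf_nearest hα hα0 hα1
    have hlt := InhomApprox.Expansion.eventually_abs_t_lt_of_R h hR4 hR hγ hM
    refine ⟨hlt, ?_⟩
    filter_upwards [hlt, Filter.eventually_ge_atTop 1] with k hk hk1 hkR
    obtain ⟨m, hm⟩ := InhomApprox.Expansion.even_t_sub_a h γ hk1
    have hR0 : (0 : ℝ) < R := by exact_mod_cast (by omega : 0 < R)
    rw [hkR, mul_div_cancel_right₀ _ hR0.ne'] at hk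
    have hk3 : |(InhomApprox.nearest α).t γ k| < 3 := by exact_mod_cast hk
    rw [abs_lt] at hk3
    constructor
    · rintro ⟨n, hn⟩
      omega
    · rintro ⟨n, hn⟩
      omega
  · intro R hR4 hR hM
    have h := InhomApprox.isExpansionOf_regular hα hα0 (hα1.trans (by norm_num))
    have hlt := InhomApprox.Expansion.eventually_abs_t_lt_of_eps_one h (fun _ => rfl) hR4 hR hγ hM
    refine ⟨hlt, ?_⟩
    filter_upwards [hlt, Filter.eventually_ge_atTop 1] with k hk hk1 hkR
    obtain ⟨m, hm⟩ := InhomApprox.Expansion.even_t_sub_a h γ hk1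
    have hR0 : (4 : ℝ) ≤ R := by exact_mod_cast hR4
    rw [hkR] at hk
    constructor
    · intro ho
      have hodd : InhomApprox.oddCeil R = R := if_pos (hkR ▸ ho)
      rw [hodd, lt_div_iff₀ (by linarith)] at hk
      -- For R ≥ 4 one has 2R/(R − 1) < 3, and t is odd.
      have hk3 : |(InhomApprox.regular α).t γ k| < 3 := by
        by_contra! hc
        have hc' : (3 : ℝ) ≤ ((|(InhomApprox.regular α).t γ k| : ℤ) : ℝ) := by exact_mod_cast hc
        nlinarith
      rw [abs_lt] at hk3
      obtain ⟨n, hn⟩ := ho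
      omega
    · intro he
      have hodd : InhomApprox.oddCeil R = R + 1 := if_neg (Int.not_odd_iff_even.2 (hkR ▸ he))
      rw [hodd] at hk
      push_cast at hk
      rw [add_sub_cancel_right, mul_div_cancel_right₀ _ (by linarith)] at hk
      -- For even R the bound 2R/(R_* − 1) is exactly 2, which leaves only t = 0 among the even
      -- integers.
      have hk3 : |(InhomApprox.regular α).t γ k| < 2 := by exact_mod_cast hk
      rw [abs_lt] at hk3
      obtain ⟨n, hn⟩ := he
      omega
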